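/- Let $G$ be a finite simple bipartite graph whose vertex set is partitioned into two parts $U,W$ such that every edge joins $U$ to $W$, every vertex of $U$ has degree $c$ and every vertex of $W$ has degree $d$. Let $g$ be the girth of $G$ (with $g=\infty$ if $G$ has no cycle), and let $i\ge 0$ and $k\ge 1$ be integers with $k<g-\frac i2$ (so $i<2g$). Notation. A cycle is regarded as a subgraph, and $N_i$ is the number of cycles of length $i$ in $G$. A closed walk is a sequence of vertices with a definite initial vertex; it contains a cycle if it traverses every edge of that cycle, and it is cycle-free if the graph formed by its edges has no cycle. Let $b_{c,2s}$ (resp. $b_{d,2s}$) be the number of closed cycle-free walks of length $2s$ in $G$ that start at an arbitrarily fixed vertex of degree $c$ (resp. $d$). Let $T_{c,d}$ be the infinite rooted tree whose root has $c-1$ children and in which the vertices on levels $1,2,3,4,\dots$ have degrees $d,c,d,c,\dots$; let $t_{c,2s}$ be the number of closed walks of length $2s$ in $T_{c,d}$ that start at the root, and let $t_{d,2s}$ be the same number for $T_{d,c}$. In particular $b_{c,0}=b_{d,0}=t_{c,0}=t_{d,0}=1$. (a) Let $\Phi(i,2k)$ be the set of closed walks of length $i+2k$ in $G$ that contain a cycle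 of length $i$ and whose initial vertex lies on that cycle. Then $$|\Phi(i,2k)|=i\,N_i\sum_{s_0+\dots+s_i=k}\bigl(b_{c,2s_i}+b_{d,2s_i}\bigr)\prod_{j=0}^{\frac i2-1}t_{d,2s_{2j}}\,t_{c,2s_{2j+1}},$$ where the sum runs over all tuples $(s_0,\dots,s_i)$ of nonnegative integers with sum $k$. (If $i$ is odd, or $i=0$, then $N_i=0$ and both sides are $0$.) (b) Let $v_0,v_1,\dots,v_{i-1},v_i=v_0$ be the consecutive vertices of a cycle $\mathscr C$ of length $i$ in $G$, listed in one of its two directions from any of its vertices $v_0$, and let $s_0,\dots,s_i\ge 0$ be integers with $s_0+\dots+s_i=k$. Let $\Phi_{v_0}(2s_0,\dots,2s_i)$ be the set of closed walks $\mathscr W$ of length $i+2k$ starting at $v_0$ that contain $\mathscr C$, go around $\mathscr C$ in the chosen direction (that is, they make more steps of the form $v_j\to v_{j+1}$ than of the form $v_{j+1}\to v_j$, $0\le j<i$), and have the following property: if $\tau_0=0$ and $\tau_j$ is the first position after $\tau_{j-1}$ at which $\mathscr W$ is at $v_j$ ($1\le j\le i$), then $\tau_1,\dots,\tau_i$ exist,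 $\tau_{j+1}-\tau_j=2s_j+1$ for $0\le j<i$, and $(i+2k)-\tau_i=2s_i$. Then $$|\Phi_{v_0}(2s_0,\dots,2s_i)|=b_{c,2s_i}\prod_{j=0}^{\frac i2-1}t_{c,2s_{2j}}\,t_{d,2s_{2j+1}}\quad\text{if } v_0\in U,$$ $$|\Phi_{v_0}(2s_0,\dots,2s_i)|=b_{d,2s_i}\prod_{j=0}^{\frac i2-1}t_{d,2s_{2j}}\,t_{c,2s_{2j+1}}\quad\text{if } v_0\in W.$$ -/

import Mathlib

/-- `G` is a `(c, d)`-biregular bipartite graph with parts `U` and `W`: the two parts partition the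
vertex set, every edge joins `U` to `W`, the vertices of `U` have degree `c` and those of `W` have
degree `d`. -/
structure IsBiregularBipartite {V : Type*} [Fintype V] (G : SimpleGraph V) [DecidableRel G.Adj]
    (U W : Set V) (c d : ℕ) : Prop where
  isBipartiteWith : G.IsBipartiteWith U W
  union_eq_univ : U ∪ W = Set.univ
  degree_left : ∀ u ∈ U, G.degree u = c
  degree_right : ∀ w ∈ W, G.degree w = d

/-- The (undirected, unrooted) cycles of length `i` of `G`, as subgraphs. -/
def cyclesOfLength {V : Type*} (G : SimpleGraph V) (i : ℕ) : Set G.Subgraph :=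
  {H | ∃ (v : V) (p : G.Walk v v), p.IsCycle ∧ p.length = i ∧ p.toSubgraph = H}

/-- `N_i`, the number of cycles of length `i` of `G`. -/
noncomputable def numCycles {V : Type*} (G : SimpleGraph V) (i : ℕ) : ℕ :=
  (cyclesOfLength G i).ncard

/-- A walk is cycle-free if the graph formed by its edges has no cycle. -/
def IsCycleFree {V : Type*} {G : SimpleGraph V} {u v : V} (p : G.Walk u v) : Prop :=
  (SimpleGraph.fromEdgeSet {e | e ∈ p.edges}).IsAcyclic

/-- The number of closed cycle-free walks of length `n` in `G` with initial vertex `v`. -/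
noncomputable def numClosedCycleFree {V : Type*} (G : SimpleGraph V) (v : V) (n : ℕ) : ℕ :=
  {p : G.Walk v v | p.length = n ∧ IsCycleFree p}.ncard

/-- A vertex of the related tree is encoded by the list of choices that leads to it from the root
(last choice first): a vertex on an even level has `c - 1` children, a vertex on an odd level has
`d - 1` children. -/
def IsTreeAddress (c d : ℕ) : List ℕ → Prop
  | [] => True
  | a :: l => a < (if Even l.length then c - 1 else d - 1) ∧ IsTreeAddress c d l

/-- The related tree `T_{c,d}`: the infinite rooted tree whose root has degree `c - 1` and in which
the vertices of the levels `1, 2, 3, 4, …` have degrees `d, c, d, c, …`. -/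
def relatedTree (c d : ℕ) : SimpleGraph {l : List ℕ // IsTreeAddress c d l} where
  Adj x y := (∃ a, y.1 = a :: x.1) ∨ (∃ a, x.1 = a :: y.1)
  symm := ⟨fun _ _ h => h.symm⟩
  loopless := ⟨fun x h => by
    rcases h with ⟨a, h⟩ | ⟨a, h⟩ <;> exact absurd (congrArg List.length h) (by simp)⟩

/-- `t_{c,n}`: the number of closed cycle-free walks of length `n` in `T_{c,d}` that start at the
root. With `c` and `d` exchanged this is `t_{d,n}`. -/
noncomputable def numTreeClosed (c d n : ℕ) : ℕ :=
  numClosedCycleFree (relatedTree c d) ⟨[], trivial⟩ n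

/-- `Φ(i, 2k)`: the closed walks of length `i + 2k` that contain a cycle of length `i` and whose
initial vertex lies on that cycle. -/
def closedWalksOnCycle {V : Type*} (G : SimpleGraph V) (i k : ℕ) : Set (Σ v : V, G.Walk v v) :=
  {p | p.2.length = i + 2 * k ∧
    ∃ H ∈ cyclesOfLength G i, H ≤ p.2.toSubgraph ∧ p.1 ∈ H.verts}

open Classical in
/-- Let the closed walk `C` run once around a cycle; this fixes a direction on the cycle. The walk
`p` follows that direction if it steps along `C` more often than against `C`. -/
def FollowsDirection {V : Type*} {G : SimpleGraph V} {v : V} (C p : G.Walk v v) : Prop :=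
  p.darts.countP (fun e => decide (e ∈ C.reverse.darts)) <
    p.darts.countP (fun e => decide (e ∈ C.darts))

/-- Let `v_j = C.getVert j`. The positions `τ 0 = 0 < τ 1 < … < τ i` in the walk `p` are those at
which `v_0, v_1, …, v_i = v_0` appear, each for the first time after the previous one; they cut
`p` into subwalks `p_0, …, p_i`, of lengths `2 s_0 + 1, …, 2 s_{i-1} + 1, 2 s_i`. -/
def HasExcursionLengths {V : Type*} {G : SimpleGraph V} {v : V} (C p : G.Walk v v)
    (s : ℕ → ℕ) : Prop :=
  ∃ τ : ℕ → ℕ, τ 0 = 0 ∧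
    (∀ j < C.length,
      τ j < τ (j + 1) ∧ τ (j + 1) ≤ p.length ∧
      p.getVert (τ (j + 1)) = C.getVert (j + 1) ∧
      (∀ m, τ j < m → m < τ (j + 1) → p.getVert m ≠ C.getVert (j + 1)) ∧
      τ (j + 1) - τ j = 2 * s j + 1) ∧
    p.length - τ C.length = 2 * s C.length

/-- `Φ_v(2s_0, …, 2s_i)` for the cycle traversed by `C`, where `C` starts at `v` and has length
`i`: the closed walks of length `i + 2k` that start at `v`, contain the cycle, go around it in the
direction of `C`, and have the excursion lengths `2s_0, …, 2s_i`. -/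
def closedWalksWithExcursions {V : Type*} {G : SimpleGraph V} {v : V} (C : G.Walk v v) (k : ℕ)
    (s : ℕ → ℕ) : Set (G.Walk v v) :=
  {p | p.length = C.length + 2 * k ∧ C.toSubgraph ≤ p.toSubgraph ∧ FollowsDirection C p ∧
    HasExcursionLengths C p s}

/-! A closed walk with fewer than `2 g` steps is too short to use every edge of a cycle twice, so
some edge `a b` of the cycle is traversed exactly once. The rest of the walk then spans a forest
(`isAcyclic_of_traverse_once`): a second cycle would supply another edge traversed once, and
crossing over where the pieces of the walk meet would give two cycles whose total length is at most
that of the walk. Paths in a forest are unique, so up to direction the walk contains only one cycle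
through its initial vertex, and it meets the vertices of that cycle in one of the two cyclic orders
(`exists_unique_cycle`).

For (b), cut the walk at the successive first visits to `v_1, …, v_i`. A piece that enters `v_{j+1}`
from a vertex other than `v_j` closes up to a cycle. It is then so long that no steps are left for
other excursions, and the walk would miss the edge `v_j v_{j+1}`. So each of these pieces is a
closed excursion at `v_j` avoiding `v_{j+1}`, followed by the cycle edge (`mem_excursionWalks`).
Conversely, the excursions are shorter than `g`, hence cycle-free; they use every edge equally often
in both directions and cannot spoil the direction of the walk (`followsDirection`). Short excursions
see only a tree, and cutting at the first return to the start gives the same recursion in `G` and in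
the related tree (`ncard_closedWalksAvoiding`). The count in (b) is the product over the excursions.

For (a), `Φ(i, 2k)` is the disjoint union of the sets of (b) over all rooted oriented cycles and all
excursion lengths. There are `2 i N_i` rooted oriented cycles, half of them rooted in each part, and
permuting the summation variables gives both halves the same product. -/

namespace SimpleGraph

variable {V : Type*} {G : SimpleGraph V}

/-! ### Cycles contained in closed walks shorter than `2 g` -/

/-- Every cycle of `G` has length at least `g`. -/
def GirthAtLeast (G : SimpleGraph V) (g : ℕ) : Prop :=
  ∀ (v : V) (C : G.Walk v v), C.IsCycle → g ≤ C.length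

/-- Pigeonhole: if every element of `l` occurred twice, `l ++ l` would fit into `L`. Applied to the
edges of a cycle inside a walk, this finds an edge traversed exactly once. -/
theorem _root_.List.Nodup.exists_count_eq_one {α : Type*} [DecidableEq α] {l L : List α}
    (hl : l.Nodup) (hsub : l ⊆ L) (hlen : L.length < 2 * l.length) : ∃ e ∈ l, L.count e = 1 := by
  by_contra! h
  have key : (l ++ l).Subperm L := by
    rw [List.subperm_ext_iff]
    intro x hx
    have hx : x ∈ l := by simpa using hx
    have h1 := h x hx
    have h2 : 0 < L.count x := List.count_pos_iff.mpr (hsub hx)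
    rw [List.count_append, List.count_eq_one_of_mem hl hx]
    omega
  have := key.length_le
  simp at this
  omega

theorem fromEdgeSet_le_of_subset {S : Set (Sym2 V)} (hS : S ⊆ G.edgeSet) :
    fromEdgeSet S ≤ G := by
  intro x y h
  exact hS ((fromEdgeSet_adj S).mp h).1

theorem Walk.mem_of_mem_edges_fromEdgeSet {S : Set (Sym2 V)} {u v : V}
    (p : (fromEdgeSet S).Walk u v) {e : Sym2 V} (he : e ∈ p.edges) : e ∈ S := by
  have := p.edges_subset_edgeSet he
  rw [edgeSet_fromEdgeSet] at this
  exact this.1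

theorem Walk.mem_edgeSet_fromEdgeSet {S : Set (Sym2 V)} {u v : V}
    (p : G.Walk u v) (hp : ∀ e ∈ p.edges, e ∈ S) {e : Sym2 V} (he : e ∈ p.edges) :
    e ∈ (fromEdgeSet S).edgeSet := by
  rw [edgeSet_fromEdgeSet]
  exact ⟨hp e he, G.not_isDiag_of_mem_edgeSet (p.edges_subset_edgeSet he)⟩

theorem GirthAtLeast.le_length_fromEdgeSet {g : ℕ} (hg : G.GirthAtLeast g) {S : Set (Sym2 V)}
    (hS : S ⊆ G.edgeSet) {x : V} {z : (fromEdgeSet S).Walk x x} (hz : z.IsCycle) :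
    g ≤ z.length := by
  simpa using hg x _ (hz.mapLe (fromEdgeSet_le_of_subset hS))

/-- The graph formed by fewer than `g` edges has no cycle. -/
theorem GirthAtLeast.isAcyclic_of_length_lt {g : ℕ} (hg : G.GirthAtLeast g)
    {l : List (Sym2 V)} (hl : ∀ e ∈ l, e ∈ G.edgeSet) (hlen : l.length < g) :
    (fromEdgeSet {e | e ∈ l}).IsAcyclic := by
  intro x z hz
  have h1 := hg.le_length_fromEdgeSet hl hz
  have h2 : z.edges.length ≤ l.length :=
    (List.subperm_of_subset hz.edges_nodup
      fun e he => z.mem_of_mem_edges_fromEdgeSet he).length_le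
  rw [Walk.length_edges] at h2
  omega

theorem GirthAtLeast.isCycleFree {g : ℕ} (hg : G.GirthAtLeast g) {u v : V} (p : G.Walk u v)
    (hp : p.length < g) : IsCycleFree p :=
  hg.isAcyclic_of_length_lt (fun _ he => p.edges_subset_edgeSet he) (by simpa using hp)

/-- Shortening `q` to a path and adding the edge `u w` gives a cycle. This is the form in which the
girth bound is mostly used below. -/
theorem GirthAtLeast.le_length_of_notMem_edges {g : ℕ} (hg : G.GirthAtLeast g) {u w : V}
    (h : G.Adj u w) (q : G.Walk w u) (hq : s(u, w) ∉ q.edges) : g ≤ q.length + 1 := by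
  classical
  have hC : (Walk.cons h q.bypass).IsCycle := by
    rw [Walk.cons_isCycle_iff]
    exact ⟨q.bypass_isPath, fun he => hq (q.edges_bypass_subset_edges he)⟩
  have h1 := hg _ _ hC
  have h2 := q.length_bypass_le_length
  simp only [Walk.length_cons] at h1
  omega

theorem Walk.exists_eq_append_cons {u v : V} (p : G.Walk u v) {d : G.Dart} (hd : d ∈ p.darts) :
    ∃ (q : G.Walk u d.fst) (r : G.Walk d.snd v), p = q.append (Walk.cons d.adj r) := by
  induction p with
  | nil => simp at hd
  | cons h p ih =>
    rw [Walk.darts_cons, List.mem_cons] at hd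
    rcases hd with rfl | hd
    · exact ⟨.nil, p, rfl⟩
    · obtain ⟨q, r, rfl⟩ := ih hd
      exact ⟨.cons h q, r, rfl⟩

theorem Walk.exists_eq_append_cons_of_mem_edges {u v : V} (p : G.Walk u v) {e : Sym2 V}
    (he : e ∈ p.edges) :
    ∃ (a b : V) (h : G.Adj a b) (q : G.Walk u a) (r : G.Walk b v),
      s(a, b) = e ∧ p = q.append (Walk.cons h r) := by
  obtain ⟨d, hd, rfl⟩ := List.mem_map.mp he
  obtain ⟨q, r, h⟩ := p.exists_eq_append_cons hd
  exact ⟨_, _, d.adj, q, r, rfl, h⟩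

/-- Two paths with edges in an acyclic graph and with the same end points coincide. -/
theorem Walk.IsPath.eq_of_isAcyclic_fromEdgeSet {S : Set (Sym2 V)}
    (hS : (fromEdgeSet S).IsAcyclic) {u v : V} {p q : G.Walk u v} (hp : p.IsPath) (hq : q.IsPath)
    (hpS : ∀ e ∈ p.edges, e ∈ S) (hqS : ∀ e ∈ q.edges, e ∈ S) : p = q := by
  have hp' := hp.transfer fun _ => p.mem_edgeSet_fromEdgeSet hpS
  have hq' := hq.transfer fun _ => q.mem_edgeSet_fromEdgeSet hqS
  have := congrArg (fun r : (fromEdgeSet S).Path u v => r.1.support)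
    ((hS.subsingleton_path u v).elim ⟨_, hp'⟩ ⟨_, hq'⟩)
  simp only [Walk.support_transfer] at this
  exact Walk.ext_support this

/-- If a closed walk that is shorter than `2 g` traverses the edge `a b` exactly once, then its
other edges form an acyclic graph. -/
theorem GirthAtLeast.isAcyclic_of_traverse_once {g : ℕ} (hg : G.GirthAtLeast g) {a b : V}
    (h : G.Adj a b) (w : G.Walk b a) (hw : s(a, b) ∉ w.edges) (hlen : w.length + 1 < 2 * g) :
    (fromEdgeSet {e | e ∈ w.edges}).IsAcyclic := by
  classical
  intro x z hz
  have hzg := hg.le_length_fromEdgeSet (fun e he => w.edges_subset_edgeSet he) hz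
  obtain ⟨e, hez, hew⟩ := List.Nodup.exists_count_eq_one hz.edges_nodup
    (fun e he => z.mem_of_mem_edges_fromEdgeSet he : z.edges ⊆ w.edges)
    (by simp only [Walk.length_edges]; omega)
  have hew' : e ∈ w.edges := z.mem_of_mem_edges_fromEdgeSet hez
  obtain ⟨a', b', h', q₁, q₂, rfl, rfl⟩ := w.exists_eq_append_cons_of_mem_edges hew'
  simp only [Walk.edges_append, Walk.edges_cons, List.count_append, List.count_cons_self] at hew
  have hq₁ : s(a', b') ∉ q₁.edges := List.count_eq_zero.mp (by omega)
  have hq₂ : s(a', b') ∉ q₂.edges := List.count_eq_zero.mp (by omega)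
  -- The edge `a' b'` lies on the cycle `z`, so its ends stay connected through the other edges of
  -- `w`, that is, through edges of `q₁` and `q₂`.
  obtain ⟨-, t⟩ := adj_and_reachable_delete_edges_iff_exists_cycle.mpr ⟨x, z, hz, hez⟩
  have ht' := reachable_deleteEdges_iff_exists_walk.mp t
  obtain ⟨t, ht⟩ := ht'
  have htS : ∀ e ∈ t.edges, e ∈ q₁.edges ∨ e ∈ q₂.edges := by
    intro e he
    have h1 := t.mem_of_mem_edges_fromEdgeSet he
    have h2 : e ≠ s(a', b') := fun h => ht (h ▸ he)
    simpa [h2] using h1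
  -- `t` leads from the end of `q₁` to the start of `q₂` along edges of these two walks, so they
  -- meet.
  have hc : ∃ c, c ∈ q₁.support ∧ c ∈ q₂.support := by
    by_cases hb : b' ∈ q₁.support
    · exact ⟨b', hb, q₂.start_mem_support⟩
    obtain ⟨d, hd, hd1, hd2⟩ := t.exists_boundary_dart {x | x ∈ q₁.support} q₁.end_mem_support hb
    rcases htS d.edge (List.mem_map_of_mem hd) with h1 | h1
    · exact absurd (q₁.snd_mem_support_of_mem_edges h1) hd2
    · exact ⟨d.fst, hd1, q₂.fst_mem_support_of_mem_edges h1⟩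
  obtain ⟨c, hc₁, hc₂⟩ := hc
  have hl₁ := congrArg Walk.length (q₁.take_spec hc₁)
  have hl₂ := congrArg Walk.length (q₂.take_spec hc₂)
  -- Crossing over at `c` yields a walk that closes with `a b` and one that closes with `a' b'`.
  -- Each gives a cycle, and together they use `q₁` and `q₂` once, so `w.length + 1 ≥ 2 g`.
  have k₁ := hg.le_length_of_notMem_edges h ((q₁.takeUntil c hc₁).append (q₂.dropUntil c hc₂)) (by
    intro he
    rw [Walk.edges_append, List.mem_append] at he
    apply hw
    rw [Walk.edges_append, Walk.edges_cons, List.mem_append, List.mem_cons]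
    exact he.imp (fun he => q₁.edges_takeUntil_subset_edges hc₁ he)
      (fun he => Or.inr (q₂.edges_dropUntil_subset_edges hc₂ he)))
  have k₂ := hg.le_length_of_notMem_edges h' ((q₂.takeUntil c hc₂).append (q₁.dropUntil c hc₁)) (by
    intro he
    rw [Walk.edges_append, List.mem_append] at he
    exact he.elim (fun he => hq₂ (q₂.edges_takeUntil_subset_edges hc₂ he))
      (fun he => hq₁ (q₁.edges_dropUntil_subset_edges hc₁ he)))
  simp only [Walk.length_append, Walk.length_cons] at hl₁ hl₂ k₁ k₂ hlen
  omega

/-- A closed walk at `v` that is shorter than `2 g` and contains a cycle contains at most one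
cycle through `v`, and runs through its vertices in one of the two cyclic orders. -/
theorem GirthAtLeast.exists_unique_cycle {g : ℕ} (hg : G.GirthAtLeast g) {v x : V}
    {p : G.Walk v v} (hp : p.length < 2 * g) {C₀ : G.Walk x x} (hC₀ : C₀.IsCycle)
    (hsub : C₀.edges ⊆ p.edges) :
    ∃ X : G.Walk v v, X.support.Sublist p.support ∧
      ∀ C : G.Walk v v, C.IsCycle → C.edges ⊆ p.edges → C = X ∨ C.reverse = X := by
  classical
  obtain ⟨e, -, hep⟩ := List.Nodup.exists_count_eq_one hC₀.edges_nodup hsub (by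
    have := hg _ _ hC₀
    simp only [Walk.length_edges]; omega)
  obtain ⟨a, b, h, q, r, rfl, rfl⟩ := p.exists_eq_append_cons_of_mem_edges
    (List.count_pos_iff.mp (by omega : 0 < p.edges.count e))
  simp only [Walk.edges_append, Walk.edges_cons, List.count_append, List.count_cons_self] at hep
  have hq : s(a, b) ∉ q.edges := List.count_eq_zero.mp (by omega)
  have hr : s(a, b) ∉ r.edges := List.count_eq_zero.mp (by omega)
  have hac := hg.isAcyclic_of_traverse_once h (r.append q) (by simp [hq, hr]) (by
    simp only [Walk.length_append, Walk.length_cons] at hp ⊢; omega)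
  -- `X` consists of the two forest paths from `v` to `a` and from `b` to `v`, joined by the edge `a
  -- b`. Since `bypass` only deletes vertices, `p` meets the vertices of `X` in order.
  refine ⟨q.bypass.append (Walk.cons h r.bypass), ?_, ?_⟩
  · rw [Walk.support_append, Walk.support_append, Walk.support_cons, Walk.support_cons]
    exact (q.support_bypass_sublist_support).append (r.support_bypass_sublist_support)
  have key : ∀ (c₁ : G.Walk v a) (c₂ : G.Walk b v), (c₁.append (Walk.cons h c₂)).IsCycle →
      (c₁.append (Walk.cons h c₂)).edges ⊆ (q.append (Walk.cons h r)).edges →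
      c₁.append (Walk.cons h c₂) = q.bypass.append (Walk.cons h r.bypass) := by
    intro c₁ c₂ hC hCp
    have hn := hC.edges_nodup
    simp only [Walk.edges_append, Walk.edges_cons, List.nodup_append, List.nodup_cons] at hn
    have h₁ : s(a, b) ∉ c₁.edges := fun he => hn.2.2 _ he _ (by simp) rfl
    have h₂ : s(a, b) ∉ c₂.edges := hn.2.1.1
    have hp₁ : c₁.IsPath := Walk.IsCycle.isPath_of_append_left (by simp) hC
    have hp₂ : c₂.IsPath := by
      have : c₁.append (Walk.cons h c₂) = (c₁.concat h).append c₂ := by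
        rw [Walk.concat_append]
      rw [this] at hC
      refine Walk.IsCycle.isPath_of_append_right ?_ hC
      rw [Walk.not_nil_iff_lt_length]
      simp
    have hS : ∀ e ∈ (c₁.append (Walk.cons h c₂)).edges, e ≠ s(a, b) →
        e ∈ (r.append q).edges := by
      intro e he hne
      have := hCp he
      simp only [Walk.edges_append, Walk.edges_cons, List.mem_append, List.mem_cons] at this ⊢
      tauto
    rw [hp₁.eq_of_isAcyclic_fromEdgeSet hac q.bypass_isPath
      (fun e he => hS e (by simp [he]) (fun h => h₁ (h ▸ he)))
      (fun e he => by simp [q.edges_bypass_subset_edges he]),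
      hp₂.eq_of_isAcyclic_fromEdgeSet hac r.bypass_isPath
      (fun e he => hS e (by simp [he]) (fun h => h₂ (h ▸ he)))
      (fun e he => by simp [r.edges_bypass_subset_edges he])]
  intro C hC hCp
  -- Otherwise `C` would be a cycle in the forest formed by the other edges of the walk.
  have heC : s(a, b) ∈ C.edges := by
    by_contra hcon
    have hsubS : ∀ e ∈ C.edges, e ∈ {e | e ∈ (r.append q).edges} := by
      intro e he
      have h1 := hCp he
      have h2 : e ≠ s(a, b) := fun h => hcon (h ▸ he)
      simp only [Walk.edges_append, Walk.edges_cons, List.mem_append, List.mem_cons, h2,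
        false_or] at h1
      simpa [or_comm] using h1
    exact hac _ (hC.transfer fun _ => C.mem_edgeSet_fromEdgeSet hsubS)
  obtain ⟨a', b', h', c₁, c₂, he, rfl⟩ := C.exists_eq_append_cons_of_mem_edges heC
  rcases Sym2.eq_iff.mp he with ⟨rfl, rfl⟩ | ⟨rfl, rfl⟩
  · exact Or.inl (key c₁ c₂ hC hCp)
  · right
    have hrev : (c₁.append (Walk.cons h' c₂)).reverse =
        c₂.reverse.append (Walk.cons h c₁.reverse) := by
      rw [Walk.reverse_append, Walk.reverse_cons, ← Walk.append_assoc]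
      rfl
    rw [hrev]
    refine key _ _ (hrev ▸ hC.reverse) ?_
    rw [← hrev, Walk.edges_reverse]
    exact fun e he => hCp (List.mem_reverse.mp he)

/-- A closed cycle-free walk uses every edge equally often in its two directions. -/
theorem Walk.count_darts_symm_of_isCycleFree [DecidableEq V] {v : V} {p : G.Walk v v}
    (hp : IsCycleFree p) (d : G.Dart) : p.darts.count d.symm = p.darts.count d := by
  classical
  by_cases hd : d.edge ∈ p.edges
  swap
  · rw [List.count_eq_zero.mpr, List.count_eq_zero.mpr]
    · exact fun h => hd (List.mem_map_of_mem h)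
    · exact fun h => hd (d.edge_symm ▸ List.mem_map_of_mem h)
  set F := fromEdgeSet {e | e ∈ p.edges} with hF
  have hadj : s(d.fst, d.snd) ∈ F.edgeSet := p.mem_edgeSet_fromEdgeSet (fun _ h => h) hd
  have hbr := isAcyclic_iff_forall_isBridge.mp hp hadj
  rw [isBridge_iff] at hbr
  set R := (F.deleteEdges {s(d.fst, d.snd)}).Reachable d.fst with hR
  -- The edge of `d` is a bridge of the forest. The indicator of the side away from `d.fst` changes
  -- only when the bridge is crossed, so the signed number of crossings telescopes, to zero for a
  -- closed walk.
  have hstep : ∀ {u w : V} (q : G.Walk u w), q.edges ⊆ p.edges →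
      (q.darts.count d : ℤ) - q.darts.count d.symm =
        (if R w then 0 else 1) - (if R u then 0 else 1) := by
    intro u w q
    induction q with
    | nil => simp
    | @cons u u' w h q ih =>
      intro hq
      rw [Walk.edges_cons, List.cons_subset] at hq
      have ih := ih hq.2
      have hu : R d.fst := Reachable.refl _
      simp only [Walk.darts_cons, List.count_cons]
      by_cases h1 : (⟨(u, u'), h⟩ : G.Dart) = d
      · subst h1
        have h2 : (⟨(u, u'), h⟩ : G.Dart) ≠ (⟨(u, u'), h⟩ : G.Dart).symm := Dart.symm_ne _ |>.symm
        simp only [if_pos hu, if_neg hbr, beq_iff_eq, if_neg h2, reduceIte] at ih ⊢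
        push_cast
        linarith
      by_cases h2 : (⟨(u, u'), h⟩ : G.Dart) = d.symm
      · have h3 : d = (⟨(u', u), h.symm⟩ : G.Dart) := by
          rw [← d.symm_symm, ← h2]; rfl
        subst h3
        simp only [if_pos hu, if_neg hbr, beq_iff_eq, if_neg h1, if_pos h2] at ih ⊢
        push_cast
        linarith
      · have h3 : s(u, u') ≠ s(d.fst, d.snd) := by
          intro h3
          rcases Sym2.eq_iff.mp h3 with ⟨h4, h5⟩ | ⟨h4, h5⟩
          · exact h1 (Dart.ext _ _ (Prod.ext h4 h5))
          · exact h2 (Dart.ext _ _ (Prod.ext h4 h5))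
        have h4 : (F.deleteEdges {s(d.fst, d.snd)}).Adj u u' := by
          rw [deleteEdges_adj]
          refine ⟨?_, h3⟩
          rw [hF, fromEdgeSet_adj]
          exact ⟨hq.1, h.ne⟩
        have h5 : R u ↔ R u' := ⟨fun k => k.trans h4.reachable, fun k => k.trans h4.symm.reachable⟩
        simp only [h5, beq_iff_eq, if_neg h1, if_neg h2] at ih ⊢
        push_cast
        linarith
  have := hstep p (fun _ h => h)
  simp at this
  omega

/-! ### First visits, first returns and the tree recursion -/

/-- A walk is cut at its first visit to a vertex `x`. -/
theorem Walk.exists_first_visit {u v x : V} (p : G.Walk u v) (hx : x ∈ p.support) (hne : u ≠ x) :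
    ∃ (y : V) (q : G.Walk u y) (h : G.Adj y x) (r : G.Walk x v),
      p = q.append (Walk.cons h r) ∧ x ∉ q.support := by
  induction p with
  | nil => simp at hx; exact absurd hx.symm hne
  | @cons u w v h p ih =>
    by_cases hw : w = x
    · subst hw
      exact ⟨u, .nil, h, p, rfl, by simpa using hne.symm⟩
    · have hx' : x ∈ p.support := by
        simpa [hne.symm] using hx
      obtain ⟨y, q, h', r, rfl, hq⟩ := ih hx' hw
      exact ⟨y, .cons h q, h', r, rfl, by simp [hne.symm, hq]⟩

theorem Walk.support_append_cons {u y x v : V} (q : G.Walk u y) (h : G.Adj y x) (r : G.Walk x v) :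
    (q.append (Walk.cons h r)).support = q.support ++ r.support := by
  simp [Walk.support_append]

theorem _root_.List.append_cons_inj_of_notMem_left {α : Type*} {x : α} :
    ∀ {a a' b b' : List α}, x ∉ a → x ∉ a' → a ++ x :: b = a' ++ x :: b' → a = a' ∧ b = b'
  | [], [], _, _, _, _, h => by simpa using h
  | [], _ :: _, _, _, _, h', h => by
    simp only [List.nil_append, List.cons_append, List.cons.injEq] at h
    exact absurd (h.1 ▸ List.mem_cons_self) h'
  | _ :: _, [], _, _, h', _, h => by
    simp only [List.nil_append, List.cons_append, List.cons.injEq] at h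
    exact absurd (h.1 ▸ List.mem_cons_self) h'
  | y :: a, y' :: a', b, b', h₁, h₂, h => by
    simp only [List.cons_append, List.cons.injEq] at h
    have := List.append_cons_inj_of_notMem_left (fun k => h₁ (List.mem_cons_of_mem _ k))
      (fun k => h₂ (List.mem_cons_of_mem _ k)) h.2
    simp [h.1, this.1, this.2]

/-- The cut of a walk at its first visit to a vertex `x` is unique. -/
theorem Walk.support_eq_of_append_cons_support_eq {u u' y y' x v : V} {q : G.Walk u y}
    {q' : G.Walk u' y'} {h : G.Adj y x} {h' : G.Adj y' x} {r r' : G.Walk x v}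
    (hq : x ∉ q.support) (hq' : x ∉ q'.support)
    (heq : (q.append (Walk.cons h r)).support = (q'.append (Walk.cons h' r')).support) :
    q.support = q'.support ∧ r = r' := by
  rw [Walk.support_append_cons, Walk.support_append_cons, ← r.cons_tail_support,
    ← r'.cons_tail_support] at heq
  obtain ⟨h1, h2⟩ := List.append_cons_inj_of_notMem_left hq hq' heq
  refine ⟨h1, Walk.ext_support ?_⟩
  rw [← r.cons_tail_support, ← r'.cons_tail_support, h2]

/-- The closed walks of length `n` at `u` that avoid the vertices of `S`. -/
def closedWalksAvoiding (G : SimpleGraph V) (u : V) (S : Set V) (n : ℕ) : Set (G.Walk u u) :=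
  {p | p.length = n ∧ ∀ x ∈ p.support, x ∉ S}

/-- A walk that leaves `u` to `w` and comes back to `u` for the first time from `y` returns along
the edge it started with, if it is shorter than every cycle. -/
theorem GirthAtLeast.eq_of_return {g : ℕ} (hg : G.GirthAtLeast g) {u w y : V} (hw : G.Adj u w)
    (hy : G.Adj u y) (q : G.Walk w y) (hq : u ∉ q.support) (hlen : q.length + 2 < g) : y = w := by
  by_contra hne
  have := hg.le_length_of_notMem_edges hy (q.reverse.concat hw.symm) (by
    rw [Walk.edges_concat, List.concat_eq_append, List.mem_append, List.mem_singleton]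
    rintro (he | he)
    · rw [Walk.edges_reverse, List.mem_reverse] at he
      exact hq (q.fst_mem_support_of_mem_edges he)
    · rcases Sym2.eq_iff.mp he with ⟨h1, -⟩ | ⟨-, h1⟩
      · exact hw.ne h1
      · exact hne h1)
  simp only [Walk.length_concat, Walk.length_reverse] at this
  omega

/-- The decomposition of a closed walk at `u` at its first return to `u`. -/
def firstReturnGlue (G : SimpleGraph V) (u : V) (S : Set V) (n : ℕ)
    (t : Σ m : Fin (n + 1), Σ w : {w // w ∈ {w | G.Adj u w ∧ w ∉ S}},
      G.closedWalksAvoiding w.1 {u} m × G.closedWalksAvoiding u S (n - m)) : G.Walk u u :=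
  Walk.cons t.2.1.2.1 (t.2.2.1.1.append (Walk.cons t.2.1.2.1.symm t.2.2.2.1))

theorem firstReturnGlue_injective (u : V) (S : Set V) (n : ℕ) :
    Function.Injective (G.firstReturnGlue u S n) := by
  rintro ⟨m, ⟨w, hw⟩, ⟨q, hq⟩, ⟨r, hr⟩⟩ ⟨m', ⟨w', hw'⟩, ⟨q', hq'⟩, ⟨r', hr'⟩⟩ h
  have h1 := congrArg Walk.support h
  simp only [firstReturnGlue, Walk.support_cons, List.cons.injEq, true_and] at h1
  obtain ⟨h2, rfl⟩ := Walk.support_eq_of_append_cons_support_eq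
    (fun h => hq.2 _ h rfl) (fun h => hq'.2 _ h rfl) h1
  obtain rfl : w = w' := by
    rw [← q.cons_tail_support, ← q'.cons_tail_support] at h2
    exact (List.cons.inj h2).1
  obtain rfl := Walk.ext_support h2
  obtain rfl : m = m' := Fin.ext (hq.1.symm.trans hq'.1)
  rfl

/-- A short closed walk must come back to `u` from the neighbor it left to, so it splits into a
closed walk at that neighbor avoiding `u` and a closed walk at `u`. Only the second part and the
choice of the neighbor have to respect `S`. -/
theorem GirthAtLeast.range_firstReturnGlue {g : ℕ} (hg : G.GirthAtLeast g) {u : V} {S : Set V}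
    {n : ℕ} (hS : ∀ x ∈ S, G.Adj u x) (hn : n + 2 < g) :
    Set.range (G.firstReturnGlue u S n) = G.closedWalksAvoiding u S (n + 2) := by
  apply Set.Subset.antisymm
  · rintro _ ⟨⟨m, ⟨w, hw⟩, ⟨q, hq⟩, ⟨r, hr⟩⟩, rfl⟩
    refine ⟨?_, ?_⟩
    · have := m.2
      simp only [firstReturnGlue, Walk.length_cons, Walk.length_append, hq.1, hr.1]
      omega
    · intro x hx hxS
      simp only [firstReturnGlue, Walk.support_cons, Walk.support_append_cons, List.mem_cons,
        List.mem_append] at hx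
      rcases hx with rfl | hx | hx
      · exact (hS _ hxS).ne rfl
      -- If `q` met `S` at `x`, a neighbor of `u`, returning to `u` from `x` would force `x = w`;
      -- but `w ∉ S`.
      · obtain ⟨q₁, q₂, hqq⟩ := Walk.mem_support_iff_exists_append.mp hx
        have hl := congrArg Walk.length hqq
        rw [Walk.length_append, hq.1] at hl
        have := m.2
        have := hg.eq_of_return hw.1 (hS _ hxS) q₁ (fun h => hq.2 u (by
          rw [hqq, Walk.mem_support_append_iff]; exact Or.inl h) rfl) (by omega)
        exact hw.2 (this ▸ hxS)
      · exact hr.2 x hx hxS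
  · rintro p ⟨hp, hpS⟩
    cases p with
    | nil => simp at hp
    | @cons _ w _ h p =>
      obtain ⟨y, q, h', r, rfl, hq⟩ := p.exists_first_visit p.end_mem_support h.ne'
      simp only [Walk.length_cons, Walk.length_append] at hp
      obtain rfl := hg.eq_of_return h h'.symm q hq (by omega)
      simp only [Walk.support_cons, Walk.support_append_cons, List.mem_cons, List.mem_append] at hpS
      refine ⟨⟨⟨q.length, by omega⟩, ⟨y, h, hpS y (Or.inr (Or.inl q.start_mem_support))⟩,
        ⟨q, rfl, ?_⟩, ⟨r, ?_, ?_⟩⟩, rfl⟩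
      · rintro x hx rfl
        exact hq hx
      · simp only
        omega
      · exact fun x hx => hpS x (Or.inr (Or.inr hx))

/-- The number of closed walks of length `n` starting at the root of a rooted tree in which the root
has `k` children and the vertices on the levels `1, 2, 3, 4, …` have `a, b, a, b, …` children. -/
def rootedTreeCount (k a b : ℕ) : ℕ → ℕ
  | 0 => 1
  | 1 => 0
  | n + 2 => ∑ m : Fin (n + 1), k * rootedTreeCount a b a m * rootedTreeCount k a b (n - m)
termination_by n => n

/-- Closed walks shorter than every cycle are counted as in a rooted tree. Here `P a b w u` is a
property of an edge from `w` to `u` that provides `a` further neighbors of `w` with the property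
`P b a`. -/
theorem GirthAtLeast.ncard_closedWalksAvoiding {g : ℕ} (hg : G.GirthAtLeast g)
    (P : ℕ → ℕ → V → V → Prop)
    (hP : ∀ a b w u, P a b w u → G.Adj w u ∧ {x | G.Adj w x ∧ x ∉ ({u} : Set V)}.Finite ∧
      {x | G.Adj w x ∧ x ∉ ({u} : Set V)}.ncard = a ∧
      ∀ x, G.Adj w x → x ≠ u → P b a x w) :
    ∀ (n : ℕ), n < g → ∀ (k a b : ℕ) (u : V) (S : Set V), (∀ x ∈ S, G.Adj u x) →
      {x | G.Adj u x ∧ x ∉ S}.Finite → {x | G.Adj u x ∧ x ∉ S}.ncard = k →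
      (∀ x, G.Adj u x → x ∉ S → P a b x u) →
      (G.closedWalksAvoiding u S n).Finite ∧
        (G.closedWalksAvoiding u S n).ncard = rootedTreeCount k a b n := by
  intro n
  induction n using Nat.strong_induction_on with
  | _ n ih =>
    intro hn k a b u S hS hfin hcard hnext
    match n, ih, hn with
    | 0, _, _ =>
      have : G.closedWalksAvoiding u S 0 = {Walk.nil} := by
        ext p
        constructor
        · rintro ⟨h, -⟩
          exact Walk.eq_nil_iff_nil.mpr (Walk.length_eq_zero_iff.mp h)
        · rintro rfl
          exact ⟨rfl, by simpa using fun h => (hS u h).ne rfl⟩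
      rw [this, rootedTreeCount]
      simp
    | 1, _, _ =>
      have : G.closedWalksAvoiding u S 1 = ∅ := by
        ext p
        simp only [closedWalksAvoiding, Set.mem_ofPred_eq, Set.mem_empty_iff_false, iff_false,
          not_and]
        exact fun h => absurd rfl (Walk.adj_of_length_eq_one h).ne
      rw [this, rootedTreeCount]
      simp
    | n + 2, ih, hn =>
      -- The part at the neighbor `w` avoids `{u}` and has the branching numbers shifted by one
      -- level; the part back at `u` still avoids `S`. This is why the induction varies `S`, `k`,
      -- `a` and `b`.
      have h₁ : ∀ (m : Fin (n + 1)) (w : {w // w ∈ {w | G.Adj u w ∧ w ∉ S}}),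
          (G.closedWalksAvoiding w.1 {u} m).Finite ∧
            (G.closedWalksAvoiding w.1 {u} m).ncard = rootedTreeCount a b a m := by
        intro m w
        have hm := m.2
        obtain ⟨h1, h2, h3, h4⟩ := hP _ _ _ _ (hnext w.1 w.2.1 w.2.2)
        exact ih m (by omega) (by omega) a b a w.1 {u} (by simpa using h1) h2 h3
          (fun x hx hxu => h4 x hx (by simpa using hxu))
      have h₂ : ∀ m : Fin (n + 1), (G.closedWalksAvoiding u S (n - m)).Finite ∧
            (G.closedWalksAvoiding u S (n - m)).ncard = rootedTreeCount k a b (n - m) := by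
        intro m
        exact ih (n - m) (by omega) (by omega) k a b u S hS hfin hcard hnext
      rw [← hg.range_firstReturnGlue hS hn]
      have := hfin.to_subtype
      have := fun m w => (h₁ m w).1.to_subtype
      have := fun m => (h₂ m).1.to_subtype
      have := Fintype.ofFinite {w // w ∈ {w | G.Adj u w ∧ w ∉ S}}
      refine ⟨Set.finite_range _, ?_⟩
      rw [← Set.image_univ, Set.ncard_image_of_injective _ (firstReturnGlue_injective u S n),
        Set.ncard_univ, Nat.card_sigma, rootedTreeCount]
      refine Finset.sum_congr rfl fun m _ => ?_
      rw [Nat.card_sigma]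
      simp only [Nat.card_prod, Nat.card_coe_set_eq, (h₁ _ _).2, (h₂ _).2]
      rw [Finset.sum_const, Finset.card_univ, ← Nat.card_eq_fintype_card, Nat.card_coe_set_eq,
        hcard, smul_eq_mul, mul_assoc]

/-! ### The related tree -/

/-- A graph is acyclic if its vertices have ranks such that the ranks of adjacent vertices differ
and every vertex has at most one neighbor of smaller rank. -/
theorem isAcyclic_of_rank (f : V → ℕ) (hne : ∀ x y, G.Adj x y → f x ≠ f y)
    (huniq : ∀ x y z, G.Adj x y → G.Adj x z → f y < f x → f z < f x → y = z) :
    G.IsAcyclic := by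
  classical
  intro v C hC
  -- A vertex of maximal rank on a cycle has two distinct neighbors of smaller rank there.
  obtain ⟨x, hx, hmax⟩ := C.support.toFinset.exists_max_image f ⟨v, by simp⟩
  rw [List.mem_toFinset] at hx
  have hC' : (C.rotate x hx).IsCycle := (Walk.isCycle_rotate hx).mpr hC
  have hlt : ∀ y ∈ (C.rotate x hx).support, G.Adj x y → f y < f x := by
    intro y hy hxy
    have := hmax y (List.mem_toFinset.mpr ((C.mem_support_rotate_iff x hx).mp hy))
    exact lt_of_le_of_ne this (hne _ _ hxy).symm
  have h₁ := (C.rotate x hx).adj_snd hC'.not_nil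
  have h₂ := (Walk.adj_penultimate hC'.not_nil).symm
  exact hC'.snd_ne_penultimate (huniq _ _ _ h₁ h₂ (hlt _ (Walk.getVert_mem_support _ _) h₁)
    (hlt _ (Walk.getVert_mem_support _ _) h₂))

theorem relatedTree_isAcyclic (c d : ℕ) : (relatedTree c d).IsAcyclic := by
  refine isAcyclic_of_rank (fun x => x.1.length) ?_ ?_
  · rintro x y (⟨a, h⟩ | ⟨a, h⟩) <;> simp [h]
  · rintro x y z hy hz hlt hlt'
    rcases hy with ⟨a, h⟩ | ⟨a, h⟩
    · simp [h] at hlt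
    rcases hz with ⟨b, h'⟩ | ⟨b, h'⟩
    · simp [h'] at hlt'
    rw [h] at h'
    exact Subtype.ext (List.cons.inj h').2

theorem IsAcyclic.girthAtLeast (hG : G.IsAcyclic) (g : ℕ) : G.GirthAtLeast g :=
  fun _ C hC => absurd hC (hG C)

theorem IsAcyclic.isCycleFree (hG : G.IsAcyclic) {u v : V} (p : G.Walk u v) : IsCycleFree p :=
  hG.anti (fromEdgeSet_le_of_subset fun _ he => p.edges_subset_edgeSet he)

theorem numClosedCycleFree_eq_ncard {n : ℕ} (u : V)
    (h : ∀ p : G.Walk u u, p.length = n → IsCycleFree p) :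
    numClosedCycleFree G u n = (G.closedWalksAvoiding u ∅ n).ncard := by
  unfold numClosedCycleFree closedWalksAvoiding
  congr 1
  ext p
  simpa using h p

/-- The children of a vertex of the related tree. -/
theorem relatedTree_children (c d : ℕ) (x : {l : List ℕ // IsTreeAddress c d l}) :
    {w : {l : List ℕ // IsTreeAddress c d l} | ∃ a, w.1 = a :: x.1}.Finite ∧
    {w : {l : List ℕ // IsTreeAddress c d l} | ∃ a, w.1 = a :: x.1}.ncard =
      if Even x.1.length then c - 1 else d - 1 := by
  have hrange : {w : {l : List ℕ // IsTreeAddress c d l} | ∃ a, w.1 = a :: x.1} =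
      Set.range fun a : Fin (if Even x.1.length then c - 1 else d - 1) =>
        (⟨a :: x.1, a.2, x.2⟩ : {l : List ℕ // IsTreeAddress c d l}) := by
    ext w
    constructor
    · rintro ⟨a, h⟩
      have hw := w.2
      rw [h] at hw
      exact ⟨⟨a, hw.1⟩, Subtype.ext h.symm⟩
    · rintro ⟨a, rfl⟩
      exact ⟨a, rfl⟩
  rw [hrange]
  refine ⟨Set.finite_range _, ?_⟩
  rw [← Set.image_univ, Set.ncard_image_of_injective, Set.ncard_univ, Nat.card_eq_fintype_card,
    Fintype.card_fin]
  intro a b h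
  exact Fin.ext (List.cons.inj (congrArg Subtype.val h)).1

/-- In an acyclic graph every walk is cycle-free and every number bounds the girth from below, so
the recursion for short walks holds for all lengths. The edge property used says that `x` is a child
of `y`. -/
theorem numTreeClosed_eq (c d n : ℕ) :
    numTreeClosed c d n = rootedTreeCount (c - 1) (d - 1) (c - 1) n := by
  have hac := relatedTree_isAcyclic c d
  unfold numTreeClosed
  rw [numClosedCycleFree_eq_ncard _ fun p _ => hac.isCycleFree p]
  refine ((hac.girthAtLeast (n + 1)).ncard_closedWalksAvoiding
    (fun a b x y => (∃ i, x.1 = i :: y.1) ∧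
      a = (if Even x.1.length then c - 1 else d - 1) ∧
      b = (if Even x.1.length then d - 1 else c - 1)) ?_ n (by omega) _ _ _ _ ∅ (by simp)
      ?_ ?_ ?_).2
  · rintro a b x y ⟨⟨i, hi⟩, rfl, rfl⟩
    have hset : {w | (relatedTree c d).Adj x w ∧ w ∉ ({y} : Set _)} = {w | ∃ a, w.1 = a :: x.1} := by
      ext w
      constructor
      · rintro ⟨h | ⟨j, hj⟩, hw⟩
        · exact h
        · rw [hi] at hj
          exact absurd (Subtype.ext (List.cons.inj hj).2.symm) hw
      · rintro ⟨j, hj⟩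
        refine ⟨Or.inl ⟨j, hj⟩, ?_⟩
        rintro rfl
        rw [hi] at hj
        have := congrArg List.length hj
        simp at this
        omega
    rw [hset]
    refine ⟨Or.inr ⟨i, hi⟩, (relatedTree_children c d x).1, (relatedTree_children c d x).2, ?_⟩
    intro w hw hwy
    have : w ∈ {w : {l : List ℕ // IsTreeAddress c d l} | ∃ a, w.1 = a :: x.1} := hset ▸ ⟨hw, hwy⟩
    obtain ⟨j, hj⟩ := this
    refine ⟨⟨j, hj⟩, ?_⟩
    simp only [hj, List.length_cons, Nat.even_add_one]
    split_ifs <;> simp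
  · refine (relatedTree_children c d ⟨[], trivial⟩).1.subset ?_
    rintro w ⟨h | ⟨a, h⟩, -⟩
    · exact h
    · simp at h
  · have := (relatedTree_children c d ⟨[], trivial⟩).2
    simp only [List.length_nil, Even.zero, if_true] at this
    rw [← this]
    congr 1
    ext w
    simp [relatedTree]
  · rintro x (⟨i, hi⟩ | ⟨i, hi⟩) -
    · exact ⟨⟨i, hi⟩, by simp [hi]⟩
    · simp at hi

theorem ncard_neighborSet [Fintype V] [DecidableRel G.Adj] (x : V) :
    (G.neighborSet x).ncard = G.degree x := by
  rw [← Nat.card_coe_set_eq, Nat.card_eq_fintype_card, card_neighborSet_eq_degree]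

theorem ncard_neighborSet_diff [Fintype V] [DecidableRel G.Adj] {x y : V} (h : G.Adj x y) :
    {z | G.Adj x z ∧ z ∉ ({y} : Set V)}.ncard = G.degree x - 1 := by
  have : {z | G.Adj x z ∧ z ∉ ({y} : Set V)} = G.neighborSet x \ {y} := rfl
  have hy : y ∈ G.neighborSet x := h
  rw [this, Set.ncard_sdiff_singleton_of_mem hy, ncard_neighborSet]

end SimpleGraph

/-! ### Short closed walks in a biregular graph -/

section Biregular

open SimpleGraph

variable {V : Type*} [Fintype V] {G : SimpleGraph V} [DecidableRel G.Adj] {U W : Set V} {c d : ℕ}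

theorem IsBiregularBipartite.symm (hG : IsBiregularBipartite G U W c d) :
    IsBiregularBipartite G W U d c :=
  ⟨hG.isBipartiteWith.symm, Set.union_comm U W ▸ hG.union_eq_univ, hG.degree_right, hG.degree_left⟩

theorem IsBiregularBipartite.mem_or_mem (hG : IsBiregularBipartite G U W c d) (x : V) :
    x ∈ U ∨ x ∈ W := by
  have : x ∈ U ∪ W := hG.union_eq_univ ▸ Set.mem_univ x
  exact this

theorem IsBiregularBipartite.mem_right (hG : IsBiregularBipartite G U W c d) {x y : V}
    (hx : x ∈ U) (h : G.Adj x y) : y ∈ W := hG.isBipartiteWith.mem_of_mem_adj hx h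

theorem IsBiregularBipartite.notMem_right (hG : IsBiregularBipartite G U W c d) {x : V}
    (hx : x ∈ U) : x ∉ W := fun h => Set.disjoint_left.mp hG.isBipartiteWith.disjoint hx h

/-- Closed walks that are shorter than the girth and start at a vertex of `U`. -/
theorem IsBiregularBipartite.ncard_closedWalksAvoiding (hG : IsBiregularBipartite G U W c d)
    {g n : ℕ} (hg : G.GirthAtLeast g) (hn : n < g) {u : V} (hu : u ∈ U) (S : Set V) (k : ℕ)
    (hS : ∀ x ∈ S, G.Adj u x) (hk : {x | G.Adj u x ∧ x ∉ S}.ncard = k) :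
    (G.closedWalksAvoiding u S n).Finite ∧
      (G.closedWalksAvoiding u S n).ncard = rootedTreeCount k (d - 1) (c - 1) n := by
  refine hg.ncard_closedWalksAvoiding
    (fun a b x y => G.Adj x y ∧
      (x ∈ U ∧ a = c - 1 ∧ b = d - 1 ∨ x ∈ W ∧ a = d - 1 ∧ b = c - 1)) ?_ n hn _ _ _ u S hS
      (Set.toFinite _) hk ?_
  · rintro a b x y ⟨h, h'⟩
    refine ⟨h, Set.toFinite _, ?_, ?_⟩
    · rw [ncard_neighborSet_diff h]
      rcases h' with ⟨hx, rfl, rfl⟩ | ⟨hx, rfl, rfl⟩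
      · rw [hG.degree_left x hx]
      · rw [hG.degree_right x hx]
    · intro z hz _
      refine ⟨hz.symm, ?_⟩
      rcases h' with ⟨hx, rfl, rfl⟩ | ⟨hx, rfl, rfl⟩
      · exact Or.inr ⟨hG.mem_right hx hz, rfl, rfl⟩
      · exact Or.inl ⟨hG.symm.mem_right hx hz, rfl, rfl⟩
  · exact fun z hz _ => ⟨hz.symm, Or.inr ⟨hG.mem_right hu hz, rfl, rfl⟩⟩

/-- Closed walks at `u` avoiding a neighbor of `u` are counted by the related tree. -/
theorem IsBiregularBipartite.ncard_avoiding_neighbor (hG : IsBiregularBipartite G U W c d)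
    {g n : ℕ} (hg : G.GirthAtLeast g) (hn : n < g) {u w : V} (hu : u ∈ U) (h : G.Adj u w) :
    (G.closedWalksAvoiding u {w} n).Finite ∧
      (G.closedWalksAvoiding u {w} n).ncard = numTreeClosed c d n := by
  rw [numTreeClosed_eq]
  refine hG.ncard_closedWalksAvoiding hg hn hu {w} (c - 1) (by simpa using h) ?_
  rw [ncard_neighborSet_diff h, hG.degree_left u hu]

/-- Closed walks at `u ∈ U` are counted by the cycle-free closed walks at any vertex `x` of the same
degree. -/
theorem IsBiregularBipartite.ncard_closedWalks (hG : IsBiregularBipartite G U W c d)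
    {g n : ℕ} (hg : G.GirthAtLeast g) (hn : n < g) {u x : V} (hu : u ∈ U) (hx : G.degree x = c) :
    (G.closedWalksAvoiding u ∅ n).Finite ∧
      (G.closedWalksAvoiding u ∅ n).ncard = numClosedCycleFree G x n := by
  have hdeg : ∀ y, {z | G.Adj y z ∧ z ∉ (∅ : Set V)}.ncard = G.degree y := by
    intro y
    have : {z | G.Adj y z ∧ z ∉ (∅ : Set V)} = G.neighborSet y := by
      ext; simp
    rw [this, ncard_neighborSet]
  have h₁ := hG.ncard_closedWalksAvoiding hg hn hu ∅ c (by simp)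
    (by rw [hdeg, hG.degree_left u hu])
  refine ⟨h₁.1, ?_⟩
  rw [h₁.2, numClosedCycleFree_eq_ncard x fun p hp => hg.isCycleFree p (hp ▸ hn)]
  rcases hG.mem_or_mem x with h | h
  · exact (hG.ncard_closedWalksAvoiding hg hn h ∅ c (by simp) (by rw [hdeg, hx])).2.symm
  -- A vertex `x` of degree `c` may lie in `W`, but then `c = d` and the parts can be exchanged.
  · have hcd : c = d := hx.symm.trans (hG.degree_right x h)
    subst hcd
    exact (hG.symm.ncard_closedWalksAvoiding hg hn h ∅ c (by simp) (by rw [hdeg, hx])).2.symm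

end Biregular

/-! ### Walks along a cycle with excursions -/

namespace SimpleGraph

variable {V : Type*} {G : SimpleGraph V}

/-- The walks that visit the vertices of the walk `C` one after the other, where the first visit to
the vertex `j + 1` after that to the vertex `j` takes `2 s j + 1` steps, and `2 s C.length` steps
remain after the last visit. -/
def looseExcursionWalks : ∀ {u v : V}, G.Walk u v → (ℕ → ℕ) → Set (G.Walk u v)
  | _, _, .nil, s => {p | p.length = 2 * s 0}
  | u, v, .cons (v := w) _ C, s => {p | ∃ (y : V) (q : G.Walk u y) (h : G.Adj y w) (r : G.Walk w v),
      p = q.append (.cons h r) ∧ w ∉ q.support ∧ q.length = 2 * s 0 ∧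
      r ∈ looseExcursionWalks C fun j => s (j + 1)}

/-- The walks that follow the walk `C`, but make an excursion of length `2 s j` at the vertex `j`
that does not visit the vertex `j + 1`. -/
def excursionWalks : ∀ {u v : V}, G.Walk u v → (ℕ → ℕ) → Set (G.Walk u v)
  | _, _, .nil, s => {p | p.length = 2 * s 0}
  | u, v, .cons (v := w) h C, s => {p | ∃ (q : G.Walk u u) (r : G.Walk w v),
      p = q.append (.cons h r) ∧ w ∉ q.support ∧ q.length = 2 * s 0 ∧
      r ∈ excursionWalks C fun j => s (j + 1)}

theorem excursionWalks_subset {u v : V} (C : G.Walk u v) :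
    ∀ s, excursionWalks C s ⊆ looseExcursionWalks C s := by
  induction C with
  | nil => exact fun s p h => h
  | cons h C ih =>
    rintro s p ⟨q, r, hp, hq, hl, hr⟩
    exact ⟨_, q, h, r, hp, hq, hl, ih _ hr⟩

theorem Walk.getVert_append_cons_of_le {u y w v : V} (q : G.Walk u y) (h : G.Adj y w)
    (r : G.Walk w v) {m : ℕ} (hm : m ≤ q.length) :
    (q.append (Walk.cons h r)).getVert m ∈ q.support := by
  rw [Walk.getVert_append]
  split_ifs with h'
  · exact q.getVert_mem_support m
  · obtain rfl : m = q.length := by omega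
    simp

theorem Walk.getVert_append_cons_add {u y w v : V} (q : G.Walk u y) (h : G.Adj y w)
    (r : G.Walk w v) (m : ℕ) :
    (q.append (Walk.cons h r)).getVert (q.length + 1 + m) = r.getVert m := by
  rw [Walk.getVert_append, if_neg (by omega),
    show q.length + 1 + m - q.length = m + 1 by omega, Walk.getVert_cons_succ]

/-- The description of `looseExcursionWalks` by positions. -/
theorem mem_looseExcursionWalks_iff {u v : V} (C : G.Walk u v) :
    ∀ (p : G.Walk u v) (s : ℕ → ℕ), p ∈ looseExcursionWalks C s ↔
      ∃ τ : ℕ → ℕ, τ 0 = 0 ∧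
        (∀ j < C.length,
          τ j < τ (j + 1) ∧ τ (j + 1) ≤ p.length ∧
          p.getVert (τ (j + 1)) = C.getVert (j + 1) ∧
          (∀ m, τ j < m → m < τ (j + 1) → p.getVert m ≠ C.getVert (j + 1)) ∧
          τ (j + 1) - τ j = 2 * s j + 1) ∧
        p.length - τ C.length = 2 * s C.length := by
  induction C with
  | nil =>
    intro p s
    constructor
    · intro h
      have h' : p.length = 2 * s 0 := h
      exact ⟨fun _ => 0, rfl, by simp, by simpa using h'⟩
    · rintro ⟨τ, h0, -, h⟩
      simpa [looseExcursionWalks, h0] using h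
  | @cons u w v h C ih =>
    intro p s
    constructor
    · rintro ⟨y, q, h', r, rfl, hq, hl, hr⟩
      obtain ⟨τ, h0, h1, h2⟩ := (ih r _).mp hr
      refine ⟨fun j => Nat.casesOn j 0 fun j => q.length + 1 + τ j, rfl, ?_, ?_⟩
      · rintro (_ | j) hj
        · simp only [h0, Nat.rec_zero, Walk.length_append, Walk.length_cons, Walk.getVert_append_cons_add,
            Walk.getVert_zero, Walk.getVert_cons_succ]
          refine ⟨by omega, by omega, trivial, ?_, by omega⟩
          intro m _ hm2 hm
          exact hq (hm ▸ q.getVert_append_cons_of_le h' r (by omega))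
        · obtain ⟨k1, k2, k3, k4, k5⟩ := h1 j (by simpa using hj)
          simp only [Walk.length_append, Walk.length_cons, Walk.getVert_append_cons_add,
            Walk.getVert_cons_succ]
          refine ⟨by omega, by omega, k3, ?_, by omega⟩
          intro m hm1 hm2
          obtain ⟨m, rfl⟩ := Nat.exists_eq_add_of_le (show q.length + 1 ≤ m by omega)
          rw [Walk.getVert_append_cons_add]
          exact k4 m (by omega) (by omega)
      · simp only [Walk.length_append, Walk.length_cons]
        omega
    · rintro ⟨τ, h0, h1, h2⟩
      obtain ⟨k1, k2, k3, k4, k5⟩ := h1 0 (by simp)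
      simp only [zero_add, Walk.getVert_cons_succ, Walk.getVert_zero, h0] at k1 k2 k3 k4 k5
      obtain ⟨y, q, h', r, rfl, hq⟩ := p.exists_first_visit (k3 ▸ p.getVert_mem_support _) h.ne
      have hτ : τ 1 = q.length + 1 := by
        rcases lt_trichotomy (τ 1) (q.length + 1) with hlt | heq | hlt
        · exact absurd (q.getVert_append_cons_of_le h' r (by omega : τ 1 ≤ q.length)) (by rwa [k3])
        · exact heq
        · refine absurd ?_ (k4 (q.length + 1) (by omega) hlt)
          simpa using q.getVert_append_cons_add h' r 0
      have hmono : ∀ j ≤ C.length, q.length + 1 ≤ τ (j + 1) := by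
        intro j
        induction j with
        | zero => intro _; simp [hτ]
        | succ j ihj =>
          intro hj
          have := ihj (by omega)
          have := (h1 (j + 1) (by simp; omega)).1
          omega
      refine ⟨y, q, h', r, rfl, hq, by omega, (ih r _).mpr
        ⟨fun j => τ (j + 1) - (q.length + 1), by simp [hτ], ?_, ?_⟩⟩
      · intro j hj
        have hm := hmono j hj.le
        have hm' := hmono (j + 1) hj
        obtain ⟨i1, i2, i3, i4, i5⟩ := h1 (j + 1) (by simpa using hj)
        simp only [Walk.length_append, Walk.length_cons, Walk.getVert_cons_succ] at i1 i2 i3 i4 i5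
        dsimp only
        refine ⟨by omega, by omega, ?_, ?_, by omega⟩
        · rw [← i3, ← Walk.getVert_append_cons_add q h' r]
          congr 1
          omega
        · intro m hm1 hm2
          rw [← Walk.getVert_append_cons_add q h' r]
          exact i4 _ (by omega) (by omega)
      · have := hmono C.length le_rfl
        simp only [Walk.length_append, Walk.length_cons] at h2
        dsimp only
        omega

theorem hasExcursionLengths_iff {v : V} (C p : G.Walk v v) (s : ℕ → ℕ) :
    HasExcursionLengths C p s ↔ p ∈ looseExcursionWalks C s :=
  (mem_looseExcursionWalks_iff C p s).symm

theorem length_of_mem_looseExcursionWalks {u v : V} (C : G.Walk u v) :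
    ∀ (p : G.Walk u v) (s : ℕ → ℕ), p ∈ looseExcursionWalks C s →
      p.length = C.length + 2 * ∑ j ∈ Finset.range (C.length + 1), s j := by
  induction C with
  | nil => 
    intro p s h
    have h' : p.length = 2 * s 0 := h
    simpa using h'
  | cons h C ih =>
    rintro p s ⟨y, q, h', r, rfl, hq, hl, hr⟩
    have := ih r _ hr
    rw [Walk.length_cons, Finset.sum_range_succ', Walk.length_append, Walk.length_cons]
    omega

theorem eq_of_mem_looseExcursionWalks {u v : V} (C : G.Walk u v) :
    ∀ (p : G.Walk u v) (s s' : ℕ → ℕ), p ∈ looseExcursionWalks C s → p ∈ looseExcursionWalks C s' →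
      ∀ j ≤ C.length, s j = s' j := by
  induction C with
  | nil =>
    intro p s s' h h' j hj
    obtain rfl : j = 0 := by simpa using hj
    have h1 : p.length = 2 * s 0 := h
    have h2 : p.length = 2 * s' 0 := h'
    omega
  | cons h C ih =>
    rintro p s s' ⟨y, q, k, r, rfl, hq, hl, hr⟩ ⟨y', q', k', r', heq, hq', hl', hr'⟩ j hj
    obtain ⟨h1, rfl⟩ := Walk.support_eq_of_append_cons_support_eq hq hq' (congrArg _ heq)
    cases j with
    | zero =>
      have := congrArg List.length h1
      simp only [Walk.length_support] at this
      omega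
    | succ j => exact ih r _ _ hr hr' j (by simpa using hj)

/-- Needed for the extreme case in which one long detour leaves no steps for any other excursion. -/
theorem eq_of_mem_looseExcursionWalks_zero {u v : V} (C : G.Walk u v) :
    ∀ (p : G.Walk u v) (s : ℕ → ℕ), p ∈ looseExcursionWalks C s → (∀ j ≤ C.length, s j = 0) →
      p = C := by
  induction C with
  | nil =>
    intro p s h hs
    have h1 : p.length = 2 * s 0 := h
    rw [hs 0 le_rfl] at h1
    exact Walk.eq_nil_iff_nil.mpr (Walk.length_eq_zero_iff.mp h1)
  | cons h C ih =>
    rintro p s ⟨y, q, k, r, rfl, hq, hl, hr⟩ hs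
    obtain rfl := ih r _ hr fun j hj => hs (j + 1) (by simpa using hj)
    rw [hs 0 (by simp)] at hl
    cases q with
    | nil => rfl
    | cons => simp at hl

theorem edges_subset_of_mem_excursionWalks {u v : V} (C : G.Walk u v) :
    ∀ (p : G.Walk u v) (s : ℕ → ℕ), p ∈ excursionWalks C s → C.edges ⊆ p.edges := by
  induction C with
  | nil => intro p s _; simp
  | cons h C ih =>
    rintro p s ⟨q, r, rfl, hq, hl, hr⟩ e he
    rw [Walk.edges_cons, List.mem_cons] at he
    rw [Walk.edges_append, Walk.edges_cons, List.mem_append, List.mem_cons]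
    exact Or.inr (he.imp id fun he => ih r _ hr he)

/-- Detours that are too short to close a cycle are excursions. -/
theorem GirthAtLeast.mem_excursionWalks {g : ℕ} (hg : G.GirthAtLeast g) {u v : V}
    (C : G.Walk u v) :
    ∀ (p : G.Walk u v) (s : ℕ → ℕ), C.IsTrail → p ∈ looseExcursionWalks C s →
      (∀ j < C.length, g ≤ 2 * s j + 2 → C.edges ⊆ p.edges ∧ ∀ m ≤ C.length, m ≠ j → s m = 0) →
      p ∈ excursionWalks C s := by
  induction C with
  | nil => exact fun p s _ h _ => h
  | @cons u w v h C ih =>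
    rintro p s hC ⟨y, q, k, r, rfl, hq, hl, hr⟩ hs
    rw [Walk.isTrail_cons] at hC
    have hqe : s(u, w) ∉ q.edges := fun he => hq (q.snd_mem_support_of_mem_edges he)
    obtain rfl : y = u := by
      by_contra hne
      -- The detour `q`, the step to `w` and the edge `w u` close up to a cycle, so `g ≤ 2 s_0 + 2`.
      -- By `hs`, everything after the detour is then exactly `C`, and the edge `u w`, which must be
      -- used, has no place left in the walk.
      have hle := hg.le_length_of_notMem_edges h.symm (q.concat k) (by
        rw [Walk.edges_concat, List.concat_eq_append, List.mem_append, List.mem_singleton]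
        rintro (he | he)
        · exact hqe (Sym2.eq_swap ▸ he)
        · rcases Sym2.eq_iff.mp he with ⟨h1, -⟩ | ⟨-, h1⟩
          · exact k.ne h1.symm
          · exact hne h1.symm)
      rw [Walk.length_concat] at hle
      obtain ⟨h1, h2⟩ := hs 0 (by simp) (by omega)
      obtain rfl := eq_of_mem_looseExcursionWalks_zero C r _ hr
        fun j hj => h2 (j + 1) (by simpa using hj) (by omega)
      have h3 : s(u, w) ∈ (q.append (Walk.cons k r)).edges := h1 (by simp)
      rw [Walk.edges_append, Walk.edges_cons, List.mem_append, List.mem_cons] at h3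
      rcases h3 with h3 | h3 | h3
      · exact hqe h3
      · rcases Sym2.eq_iff.mp h3 with ⟨h4, -⟩ | ⟨h4, h5⟩
        · exact hne h4.symm
        · exact h.ne h4
      · exact hC.2 h3
    refine ⟨q, r, rfl, hq, hl, ih r _ hC.1 hr ?_⟩
    intro j hj hgj
    obtain ⟨h1, h2⟩ := hs (j + 1) (by simpa using hj) hgj
    refine ⟨?_, fun m hm hmj => h2 (m + 1) (by simpa using hm) (by omega)⟩
    intro e he
    have h3 : e ∈ (q.append (Walk.cons k r)).edges := h1 (by simp [he])
    rw [h2 0 (by simp) (by omega)] at hl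
    obtain rfl := Walk.eq_nil_iff_nil.mpr (Walk.length_eq_zero_iff.mp hl)
    rw [Walk.nil_append, Walk.edges_cons, List.mem_cons] at h3
    exact h3.resolve_left fun h4 => hC.2 (h4 ▸ he)

/-- Short excursions do not change how often an edge is used in either direction. -/
theorem GirthAtLeast.count_darts_of_mem_excursionWalks [DecidableEq V] {g : ℕ}
    (hg : G.GirthAtLeast g) {u v : V} (C : G.Walk u v) :
    ∀ (p : G.Walk u v) (s : ℕ → ℕ), p ∈ excursionWalks C s → (∀ j ≤ C.length, 2 * s j < g) →
      ∀ d : G.Dart, p.darts.count d + C.darts.count d.symm =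
        p.darts.count d.symm + C.darts.count d := by
  induction C with
  | nil =>
    intro p s h hs d
    have h1 : p.length = 2 * s 0 := h
    rw [Walk.count_darts_symm_of_isCycleFree (hg.isCycleFree p (h1 ▸ hs 0 le_rfl))]
    simp
  | cons h C ih =>
    rintro p s ⟨q, r, rfl, hq, hl, hr⟩ hs d
    have h1 := ih r _ hr (fun j hj => hs (j + 1) (by simpa using hj)) d
    have h2 := Walk.count_darts_symm_of_isCycleFree
      (hg.isCycleFree q (hl ▸ hs 0 (by simp))) d
    simp only [Walk.darts_append, Walk.darts_cons, List.count_append, List.count_cons]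
    omega

theorem _root_.List.countP_mem_eq_sum_count {α : Type*} [DecidableEq α] (L M : List α)
    [DecidablePred (· ∈ L)] :
    M.countP (fun x => decide (x ∈ L)) = ∑ x ∈ L.toFinset, M.count x := by
  induction M with
  | nil => simp
  | cons y M ih =>
    simp only [List.countP_cons, ih, List.count_cons, Finset.sum_add_distrib, beq_iff_eq,
      Finset.sum_ite_eq, List.mem_toFinset, decide_eq_true_eq]

/-- The excursions contribute equally to both directions of each edge, and `C` uses no edge in both
directions, so each dart of `C` is traversed once more than its reverse. -/
theorem GirthAtLeast.followsDirection {g : ℕ} (hg : G.GirthAtLeast g) {v : V} {C p : G.Walk v v}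
    (hC : C.IsCycle) {s : ℕ → ℕ} (hp : p ∈ excursionWalks C s)
    (hs : ∀ j ≤ C.length, 2 * s j < g) : FollowsDirection C p := by
  classical
  unfold FollowsDirection
  have hn : (C.darts.map Dart.edge).Nodup := hC.edges_nodup
  have key : ∀ d ∈ C.darts, p.darts.count d = p.darts.count d.symm + 1 := by
    intro d hd
    have h1 := hg.count_darts_of_mem_excursionWalks C p s hp hs d
    have h2 : C.darts.count d.symm = 0 := List.count_eq_zero.mpr fun hd' =>
      d.symm_ne (List.inj_on_of_nodup_map hn hd' hd d.edge_symm)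
    rw [List.count_eq_one_of_mem hn.of_map hd, h2] at h1
    omega
  have hrev : ∑ d ∈ C.reverse.darts.toFinset, p.darts.count d =
      ∑ d ∈ C.darts.toFinset, p.darts.count d.symm := by
    refine Finset.sum_nbij' Dart.symm Dart.symm ?_ ?_ ?_ ?_ ?_ <;> simp
  rw [List.countP_mem_eq_sum_count, List.countP_mem_eq_sum_count, hrev]
  apply Finset.sum_lt_sum_of_nonempty
  · rw [List.toFinset_nonempty_iff, ne_eq, Walk.darts_eq_nil]
    exact hC.not_nil
  · intro d hd
    rw [key d (List.mem_toFinset.mp hd)]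
    omega

/-- A walk whose vertices contain those of `C` in order visits them one after the other. -/
theorem exists_mem_looseExcursionWalks {U : Set V}
    (hU : ∀ {x y : V} (p : G.Walk x y), Even p.length ↔ (x ∈ U ↔ y ∈ U)) {u v : V}
    (C : G.Walk u v) :
    ∀ p : G.Walk u v, C.support.Sublist p.support → ∃ s, p ∈ looseExcursionWalks C s := by
  induction C with
  | nil =>
    intro p _
    obtain ⟨m, hm⟩ := (hU p).mpr Iff.rfl
    exact ⟨fun _ => m, show p.length = 2 * m by omega⟩
  | @cons u w v h C ih =>
    intro p hp
    rw [Walk.support_cons] at hp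
    have hw : w ∈ p.support := hp.subset (List.mem_cons_of_mem _ C.start_mem_support)
    obtain ⟨y, q, k, r, rfl, hq⟩ := p.exists_first_visit hw h.ne
    have hsub : C.support.Sublist r.support := by
      have h1 := (List.sublist_cons_self u _).trans hp
      rw [Walk.support_append_cons] at h1
      obtain ⟨l₁, l₂, hl, hl₁, hl₂⟩ := List.sublist_append_iff.mp h1
      cases l₁ with
      | nil => rw [hl]; exact hl₂
      | cons z l₁ =>
        rw [← C.cons_tail_support] at hl
        exact absurd (hl₁.subset ((List.cons.inj hl).1 ▸ List.mem_cons_self)) hq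
    obtain ⟨s, hs⟩ := ih r hsub
    -- Both `u` and `y` are neighbors of `w`, hence on the same side of the bipartition.
    have hq' : Even q.length := by
      rw [hU q]
      have h1 := hU (Walk.cons h .nil)
      have h2 := hU (Walk.cons k .nil)
      simp at h1 h2
      tauto
    obtain ⟨m, hm⟩ := hq'
    exact ⟨fun j => Nat.casesOn j m s, y, q, k, r, rfl, hq, show q.length = 2 * m by omega, hs⟩

/-- The excursions can be chosen independently, and uniqueness of the cut at the first visit makes
the assembled walk determine them. -/
theorem ncard_excursionWalks {u v : V} (C : G.Walk u v) :
    ∀ (s : ℕ → ℕ), (excursionWalks C s).ncard =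
      (∏ j ∈ Finset.range C.length,
        (G.closedWalksAvoiding (C.getVert j) {C.getVert (j + 1)} (2 * s j)).ncard) *
      (G.closedWalksAvoiding v ∅ (2 * s C.length)).ncard := by
  induction C with
  | nil => intro s; simp [excursionWalks, closedWalksAvoiding]
  | @cons u w v h C ih =>
    intro s
    have himg : excursionWalks (Walk.cons h C) s =
        (fun t : G.Walk u u × G.Walk w v => t.1.append (Walk.cons h t.2)) ''
          (G.closedWalksAvoiding u {w} (2 * s 0) ×ˢ excursionWalks C fun j => s (j + 1)) := by
      ext p
      constructor
      · rintro ⟨q, r, rfl, hq, hl, hr⟩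
        exact ⟨(q, r), ⟨⟨hl, fun x hx hxw => hq (hxw ▸ hx)⟩, hr⟩, rfl⟩
      · rintro ⟨⟨q, r⟩, ⟨hq, hr⟩, rfl⟩
        exact ⟨q, r, rfl, fun h => hq.2 _ h rfl, hq.1, hr⟩
    rw [himg, Set.InjOn.ncard_image, Set.ncard_prod, ih, Walk.length_cons,
      Finset.prod_range_succ']
    · change _ = _ * (G.closedWalksAvoiding u {C.getVert 0} (2 * s 0)).ncard * _
      rw [Walk.getVert_zero]
      simp only [Walk.getVert_cons_succ]
      ring
    · rintro ⟨q, r⟩ ⟨hq, -⟩ ⟨q', r'⟩ ⟨hq', -⟩ heq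
      obtain ⟨h1, rfl⟩ := Walk.support_eq_of_append_cons_support_eq
        (fun h => hq.2 _ h rfl) (fun h => hq'.2 _ h rfl) (congrArg Walk.support heq)
      exact Prod.ext (Walk.ext_support h1) rfl

theorem looseExcursionWalks_congr {u v : V} (C : G.Walk u v) :
    ∀ {s s' : ℕ → ℕ}, (∀ j ≤ C.length, s j = s' j) →
      looseExcursionWalks C s = looseExcursionWalks C s' := by
  induction C with
  | nil =>
    intro s s' h
    simp only [looseExcursionWalks, h 0 le_rfl]
  | cons h C ih =>
    intro s s' hs
    simp only [looseExcursionWalks, hs 0 (Nat.zero_le _),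
      ih fun j hj => hs (j + 1) (by simpa using hj)]

theorem finite_setOf_walk_length_eq [Finite V] (u v : V) (n : ℕ) :
    {p : G.Walk u v | p.length = n}.Finite := by
  classical
  have := Fintype.ofFinite V
  exact (G.coe_finsetWalkLength_eq n u v) ▸ (G.finsetWalkLength n u v).finite_toSet

theorem Walk.toSubgraph_le_toSubgraph_iff {u v x y : V} {C : G.Walk u v} (hC : ¬ C.Nil)
    {p : G.Walk x y} : C.toSubgraph ≤ p.toSubgraph ↔ C.edges ⊆ p.edges := by
  rw [Walk.toSubgraph_le_iff hC, Walk.edgeSet_toSubgraph]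
  rfl

theorem _root_.Finset.prod_range_two_mul_eq {M : Type*} [CommMonoid M] (f : ℕ → M) (m : ℕ) :
    ∏ j ∈ Finset.range (2 * m), f j = ∏ j ∈ Finset.range m, f (2 * j) * f (2 * j + 1) := by
  induction m with
  | zero => simp
  | succ m ih =>
    rw [show 2 * (m + 1) = 2 * m + 1 + 1 by ring, Finset.prod_range_succ, Finset.prod_range_succ,
      ih, Finset.prod_range_succ, mul_assoc]

/-- A walk of length less than `2 g` that contains the cycle `C` and visits its vertices in order
follows `C`, up to excursions. -/
theorem GirthAtLeast.mem_excursionWalks_of_isCycle {g : ℕ} (hg : G.GirthAtLeast g) {v : V}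
    {C p : G.Walk v v} (hC : C.IsCycle) (hp : p.length < 2 * g) (hCp : C.edges ⊆ p.edges)
    {s : ℕ → ℕ} (hs : p ∈ looseExcursionWalks C s) : p ∈ excursionWalks C s := by
  have hgC := hg _ _ hC
  have hl := length_of_mem_looseExcursionWalks C p s hs
  refine hg.mem_excursionWalks C p s hC.isTrail hs fun j hj hgj => ⟨hCp, fun m hm hmj => ?_⟩
  -- With `C.length ≥ g` and `2 s_j + 2 ≥ g`, any further `s_m ≥ 1` would bring the length up to `2
  -- g`.
  have : s m + s j ≤ ∑ j ∈ Finset.range (C.length + 1), s j := by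
    rw [← Finset.sum_pair hmj]
    refine Finset.sum_le_sum_of_subset fun a ha => ?_
    simp only [Finset.mem_insert, Finset.mem_singleton] at ha
    rw [Finset.mem_range]
    omega
  omega

/-- Closed walks with given excursion lengths are assembled from their excursions. -/
theorem GirthAtLeast.closedWalksWithExcursions_eq {g : ℕ} (hg : G.GirthAtLeast g) {v : V}
    {C : G.Walk v v} (hC : C.IsCycle) {k : ℕ} (hk : C.length + 2 * k < 2 * g) {s : ℕ → ℕ}
    (hs : ∑ j ∈ Finset.range (C.length + 1), s j = k) :
    closedWalksWithExcursions C k s = excursionWalks C s := by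
  have hgC := hg _ _ hC
  ext p
  constructor
  · rintro ⟨hl, hCp, -, hp⟩
    rw [Walk.toSubgraph_le_toSubgraph_iff hC.not_nil] at hCp
    exact hg.mem_excursionWalks_of_isCycle hC (hl ▸ hk) hCp ((hasExcursionLengths_iff C p s).mp hp)
  · intro hp
    have hp' := excursionWalks_subset C s hp
    refine ⟨?_, ?_, hg.followsDirection hC hp fun j hj => ?_, (hasExcursionLengths_iff C p s).mpr hp'⟩
    · rw [length_of_mem_looseExcursionWalks C p s hp', hs]
    · rw [Walk.toSubgraph_le_toSubgraph_iff hC.not_nil]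
      exact edges_subset_of_mem_excursionWalks C p s hp
    -- `2 s_j ≤ 2 k < 2 g - C.length ≤ g`: each excursion is shorter than the girth bound.
    · have : s j ≤ k :=
        hs ▸ Finset.single_le_sum (fun _ _ => Nat.zero_le _) (Finset.mem_range.mpr (by omega))
      omega

/-! ### Counting rooted oriented cycles -/

/-- The closed walks of a rooted, oriented cycle. -/
def rootedCycles (G : SimpleGraph V) (i : ℕ) : Set (Σ v : V, G.Walk v v) :=
  {t | t.2.IsCycle ∧ t.2.length = i}

theorem finite_rootedCycles [Finite V] (i : ℕ) : (G.rootedCycles i).Finite := by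
  have : G.rootedCycles i ⊆ ⋃ v : V, Sigma.mk v '' {p : G.Walk v v | p.length = i} := by
    rintro ⟨v, p⟩ ⟨-, hp⟩
    exact Set.mem_iUnion.mpr ⟨v, p, hp, rfl⟩
  exact (Set.finite_iUnion fun v => (finite_setOf_walk_length_eq v v i).image _).subset this

theorem Walk.IsCycle.ne_reverse {v : V} {C : G.Walk v v} (hC : C.IsCycle) : C ≠ C.reverse := by
  intro h
  apply hC.snd_ne_penultimate
  have := congrArg Walk.snd h
  rwa [Walk.snd_reverse] at this

theorem Walk.IsCycle.ncard_verts {v : V} {C : G.Walk v v} (hC : C.IsCycle) :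
    C.toSubgraph.verts.ncard = C.length := by
  classical
  have h : C.toSubgraph.verts = (C.support.tail.toFinset : Set V) := by
    ext w
    rw [Walk.mem_verts_toSubgraph, List.coe_toFinset, Set.mem_ofPred_eq, ← C.cons_tail_support,
      List.mem_cons]
    constructor
    · rintro (rfl | h)
      · exact Walk.end_mem_tail_support hC.not_nil
      · exact h
    · exact Or.inr
  rw [h, Set.ncard_coe_finset, List.toFinset_card_of_nodup hC.support_nodup, List.length_tail,
    Walk.length_support]
  rfl

/-- The rooted oriented cycles at `v` with a given subgraph are a cycle and its reverse. -/
theorem GirthAtLeast.eq_or_eq_reverse {g : ℕ} (hg : G.GirthAtLeast g) {v : V} {p C D : G.Walk v v}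
    (hp : p.length < 2 * g) (hC : C.IsCycle) (hD : D.IsCycle) (hCp : C.edges ⊆ p.edges)
    (hDp : D.edges ⊆ p.edges) : D = C ∨ D = C.reverse := by
  obtain ⟨X, -, hX⟩ := hg.exists_unique_cycle hp hC hCp
  rcases hX C hC hCp with rfl | rfl <;> rcases hX D hD hDp with rfl | h
  · exact Or.inl rfl
  · exact Or.inr (by rw [← h, Walk.reverse_reverse])
  · exact Or.inr rfl
  · exact Or.inl (Walk.reverse_injective h)

/-- Forget first the direction and then the root: the fibers have sizes `2` and `i`. A cycle of
length below `2 g` can itself serve as the short closed walk in `eq_or_eq_reverse`. -/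
theorem ncard_rootedCycles [Finite V] {g i : ℕ} (hg : G.GirthAtLeast g) (hi : i < 2 * g) :
    (G.rootedCycles i).ncard = 2 * (i * numCycles G i) := by
  classical
  have hfin := G.finite_rootedCycles i
  set 𝒞 := hfin.toFinset with h𝒞
  have hmem : ∀ {t}, t ∈ 𝒞 ↔ t.2.IsCycle ∧ t.2.length = i := fun {t} => hfin.mem_toFinset
  rw [Set.ncard_eq_toFinset_card _ hfin, ← h𝒞]
  set f : (Σ v : V, G.Walk v v) → G.Subgraph × V := fun t => (t.2.toSubgraph, t.1) with hf
  have hroot : ∀ {H : G.Subgraph} {v : V}, H ∈ cyclesOfLength G i → v ∈ H.verts →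
      ∃ C : G.Walk v v, C.IsCycle ∧ C.length = i ∧ C.toSubgraph = H := by
    rintro _ v ⟨x, C, hC, hl, rfl⟩ hv
    rw [Walk.mem_verts_toSubgraph] at hv
    refine ⟨C.rotate v hv, (Walk.isCycle_rotate hv).mpr hC, ?_, Walk.toSubgraph_rotate C hv⟩
    have := (C.rotate_edges v hv).perm.length_eq
    rwa [Walk.length_edges, Walk.length_edges, hl] at this
  have h₁ : ∀ y ∈ 𝒞.image f, (𝒞.filter fun t => f t = y).card = 2 := by
    intro y hy
    obtain ⟨⟨v, C⟩, hC, rfl⟩ := Finset.mem_image.mp hy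
    obtain ⟨hC, hl⟩ := hmem.mp hC
    have : (𝒞.filter fun t => f t = f ⟨v, C⟩) = {⟨v, C⟩, ⟨v, C.reverse⟩} := by
      ext ⟨w, D⟩
      rw [Finset.mem_filter, hmem, Finset.mem_insert, Finset.mem_singleton]
      constructor
      · rintro ⟨⟨hD, hDl⟩, heq⟩
        obtain ⟨heq, rfl⟩ := Prod.mk.inj heq
        have hsub : D.edges ⊆ C.edges := (Walk.toSubgraph_le_toSubgraph_iff hD.not_nil).mp heq.le
        dsimp only at hl hC
        exact (hg.eq_or_eq_reverse (hl ▸ hi) hC hD (fun _ h => h) hsub).imp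
          (congrArg (Sigma.mk _)) (congrArg (Sigma.mk _))
      · rintro (h | h) <;> cases h
        · exact ⟨⟨hC, hl⟩, rfl⟩
        · exact ⟨⟨hC.reverse, by simpa using hl⟩, by simp [hf]⟩
    rw [this, Finset.card_pair]
    intro h
    exact hC.ne_reverse (eq_of_heq (Sigma.mk.inj h).2)
  have h₂ : ∀ H ∈ (𝒞.image f).image Prod.fst, ((𝒞.image f).filter fun y => y.1 = H).card = i := by
    intro H hH
    obtain ⟨y, hy, rfl⟩ := Finset.mem_image.mp hH
    obtain ⟨⟨v, C⟩, hC, rfl⟩ := Finset.mem_image.mp hy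
    obtain ⟨hC, hl⟩ := hmem.mp hC
    dsimp only at hC hl
    rw [← hl, ← hC.ncard_verts, ← Set.ncard_coe_finset,
      ← Set.ncard_image_of_injective C.toSubgraph.verts (Prod.mk_right_injective C.toSubgraph)]
    refine congrArg Set.ncard (Set.ext fun ⟨H, w⟩ => ?_)
    simp only [Finset.coe_filter, Finset.mem_image, Set.mem_ofPred_eq, Set.mem_image]
    constructor
    · rintro ⟨⟨⟨w', D⟩, hD, heq⟩, h⟩
      obtain ⟨rfl, rfl⟩ := Prod.mk.inj heq
      have h' : D.toSubgraph = C.toSubgraph := h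
      exact ⟨w', h' ▸ D.start_mem_verts_toSubgraph, Prod.ext h.symm rfl⟩
    · rintro ⟨w', hw', heq⟩
      obtain ⟨rfl, rfl⟩ := Prod.mk.inj heq
      obtain ⟨D, hD, hDl, hDC⟩ := hroot ⟨v, C, hC, hl, rfl⟩ hw'
      exact ⟨⟨⟨_, D⟩, hmem.mpr ⟨hD, hDl⟩, Prod.ext hDC rfl⟩, rfl⟩
  have h₃ : (((𝒞.image f).image Prod.fst : Finset G.Subgraph) : Set G.Subgraph) =
      cyclesOfLength G i := by
    ext H
    simp only [Finset.coe_image, Set.mem_image, Finset.mem_coe]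
    constructor
    · rintro ⟨_, ⟨⟨v, C⟩, hC, rfl⟩, rfl⟩
      exact ⟨v, C, (hmem.mp hC).1, (hmem.mp hC).2, rfl⟩
    · rintro ⟨v, C, hC, hl, rfl⟩
      exact ⟨_, ⟨⟨v, C⟩, hmem.mpr ⟨hC, hl⟩, rfl⟩, rfl⟩
  rw [Finset.card_eq_sum_card_image f, Finset.sum_const_nat h₁,
    Finset.card_eq_sum_card_image Prod.fst, Finset.sum_const_nat h₂, numCycles, ← h₃,
    Set.ncard_coe_finset]
  ring

/-- Moves the root of a closed walk one step further. -/
def rotateOne : (Σ v : V, G.Walk v v) → Σ v : V, G.Walk v v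
  | ⟨v, .nil⟩ => ⟨v, .nil⟩
  | ⟨_, .cons (v := w) h q⟩ => ⟨w, q.concat h⟩

theorem rotateOne_injOn (i : ℕ) : Set.InjOn (rotateOne (G := G)) (G.rootedCycles i) := by
  rintro ⟨v, C⟩ ⟨hC, -⟩ ⟨v', C'⟩ ⟨hC', -⟩ h
  cases C with
  | nil => simp at hC
  | cons k q =>
    cases C' with
    | nil => simp at hC'
    | cons k' q' =>
      simp only [rotateOne, Sigma.mk.injEq] at h
      obtain ⟨rfl, h⟩ := h
      obtain ⟨rfl, h⟩ := Walk.concat_inj (eq_of_heq h)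
      rw [Walk.copy_rfl_rfl] at h
      rw [h]

theorem rotateOne_mem {i : ℕ} {t : Σ v : V, G.Walk v v} (ht : t ∈ G.rootedCycles i) :
    rotateOne t ∈ G.rootedCycles i ∧ G.Adj t.1 (rotateOne t).1 := by
  obtain ⟨v, C⟩ := t
  obtain ⟨hC, hl⟩ := ht
  cases C with
  | nil => simp at hC
  | cons h q =>
    refine ⟨⟨?_, by simpa [rotateOne] using hl⟩, h⟩
    rw [Walk.cons_isCycle_iff] at hC
    rw [← Walk.isCycle_reverse]
    simp only [rotateOne, Walk.reverse_concat]
    rw [Walk.cons_isCycle_iff, Walk.edges_reverse, List.mem_reverse, Sym2.eq_swap]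
    exact ⟨hC.1.reverse, hC.2⟩

end SimpleGraph

/-! ### Roots in the two parts and the count for given excursion lengths -/

section Biregular

open SimpleGraph

variable {V : Type*} [Fintype V] {G : SimpleGraph V} [DecidableRel G.Adj] {U W : Set V} {c d : ℕ}

theorem IsBiregularBipartite.even_length_iff (hG : IsBiregularBipartite G U W c d) {x y : V}
    (p : G.Walk x y) : Even p.length ↔ (x ∈ U ↔ y ∈ U) := by
  induction p with
  | nil => simp
  | @cons x z y h p ih =>
    have hxz : x ∈ U ↔ z ∉ U := by
      constructor
      · exact fun hx hz => hG.notMem_right hz (hG.mem_right hx h)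
      · exact fun hz => hG.symm.mem_right ((hG.mem_or_mem z).resolve_left hz) h.symm
    rw [Walk.length_cons, Nat.even_add_one, ih]
    tauto

/-- Moving the root one step along the cycle injects the cycles rooted in `U` into those rooted in
`W`. With the reverse inequality, the two halves have equal size. -/
theorem IsBiregularBipartite.ncard_rootedCycles_inter_le (hG : IsBiregularBipartite G U W c d)
    (i : ℕ) : (G.rootedCycles i ∩ {t | t.1 ∈ U}).ncard ≤ (G.rootedCycles i ∩ {t | t.1 ∈ W}).ncard :=
  Set.ncard_le_ncard_of_injOn rotateOne
    (fun _ ht => ⟨(rotateOne_mem ht.1).1, hG.mem_right ht.2 (rotateOne_mem ht.1).2⟩)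
    ((rotateOne_injOn i).mono Set.inter_subset_left)
    ((G.finite_rootedCycles i).subset Set.inter_subset_left)

theorem IsBiregularBipartite.ncard_rootedCycles_inter (hG : IsBiregularBipartite G U W c d)
    {g i : ℕ} (hg : G.GirthAtLeast g) (hi : i < 2 * g) :
    (G.rootedCycles i ∩ {t | t.1 ∈ U}).ncard = i * numCycles G i := by
  have h₁ := hG.ncard_rootedCycles_inter_le i
  have h₂ := hG.symm.ncard_rootedCycles_inter_le i
  have h₃ : (G.rootedCycles i ∩ {t | t.1 ∈ U}).ncard + (G.rootedCycles i ∩ {t | t.1 ∈ W}).ncard =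
      (G.rootedCycles i).ncard := by
    rw [← Set.ncard_inter_add_ncard_sdiff_eq_ncard (G.rootedCycles i) {t | t.1 ∈ U}
      (G.finite_rootedCycles i)]
    congr 2
    ext t
    refine and_congr_right fun _ => ⟨fun h h' => hG.notMem_right h' h, fun h => ?_⟩
    exact (hG.mem_or_mem t.1).resolve_left h
  rw [ncard_rootedCycles hg hi] at h₃
  omega

/-- The number of closed walks with given excursion lengths around a cycle rooted in `U`. -/
theorem IsBiregularBipartite.ncard_closedWalksWithExcursions
    (hG : IsBiregularBipartite G U W c d) {g : ℕ} (hg : G.GirthAtLeast g) {v x : V} (hv : v ∈ U)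
    (hx : G.degree x = c) {C : G.Walk v v} (hC : C.IsCycle) {k : ℕ}
    (hk : C.length + 2 * k < 2 * g) {s : ℕ → ℕ}
    (hs : ∑ j ∈ Finset.range (C.length + 1), s j = k) :
    (closedWalksWithExcursions C k s).ncard =
      numClosedCycleFree G x (2 * s C.length) * ∏ j ∈ Finset.range (C.length / 2),
        numTreeClosed c d (2 * s (2 * j)) * numTreeClosed d c (2 * s (2 * j + 1)) := by
  have hgC := hg _ _ hC
  have hle : ∀ j ≤ C.length, 2 * s j < g := by
    intro j hj
    have : s j ≤ k :=
      hs ▸ Finset.single_le_sum (fun _ _ => Nat.zero_le _) (Finset.mem_range.mpr (by omega))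
    omega
  rw [hg.closedWalksWithExcursions_eq hC hk hs, ncard_excursionWalks,
    (hG.ncard_closedWalks hg (hle _ le_rfl) hv hx).2, mul_comm]
  congr 1
  have heven : 2 * (C.length / 2) = C.length :=
    Nat.two_mul_div_two_of_even ((hG.even_length_iff C).mpr Iff.rfl)
  -- The root lies in `U`, so the parity of the position on `C` decides which related tree counts
  -- the excursion.
  have hcol : ∀ j ≤ C.length, Even j ↔ C.getVert j ∈ U := by
    intro j hj
    have := hG.even_length_iff (C.take j)
    rw [Walk.take_length, min_eq_left hj] at this
    tauto
  conv_lhs => rw [← heven]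
  rw [Finset.prod_range_two_mul_eq]
  refine Finset.prod_congr rfl fun j hj => ?_
  rw [Finset.mem_range] at hj
  have h₀ := (hcol (2 * j) (by omega)).mp (even_two_mul j)
  have h₁ : C.getVert (2 * j + 1) ∈ W := (hG.mem_or_mem _).resolve_left fun h =>
    absurd ((hcol (2 * j + 1) (by omega)).mpr h) (by simp)
  rw [(hG.ncard_avoiding_neighbor hg (hle _ (by omega)) h₀ (C.adj_getVert_succ (by omega))).2,
    (hG.symm.ncard_avoiding_neighbor hg (hle _ (by omega)) h₁ (C.adj_getVert_succ (by omega))).2]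

end Biregular

/-! ### Decomposition of `Φ(i, 2k)` by cycle, root, direction and excursion lengths -/

namespace SimpleGraph

variable {V : Type*} {G : SimpleGraph V}

theorem cyclesOfLength_eq_empty {i : ℕ} (h : G.rootedCycles i = ∅) : cyclesOfLength G i = ∅ := by
  rw [Set.eq_empty_iff_forall_notMem] at h ⊢
  rintro _ ⟨v, C, hC, hl, rfl⟩
  exact h ⟨v, C⟩ ⟨hC, hl⟩

theorem _root_.FollowsDirection.not_reverse {v : V} {C p : G.Walk v v} (h : FollowsDirection C p) :
    ¬ FollowsDirection C.reverse p := by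
  intro h'
  unfold FollowsDirection at h h'
  rw [Walk.reverse_reverse] at h'
  exact lt_asymm h h'

/-- A closed walk shorter than `2 g` goes around at most one rooted oriented cycle, with only one
sequence of excursion lengths. -/
theorem GirthAtLeast.eq_of_mem_closedWalksWithExcursions {g : ℕ} (hg : G.GirthAtLeast g) {v : V}
    {C D p : G.Walk v v} (hC : C.IsCycle) (hD : D.IsCycle) {k : ℕ} (hk : C.length + 2 * k < 2 * g)
    {s s' : ℕ → ℕ} (hp : p ∈ closedWalksWithExcursions C k s)
    (hp' : p ∈ closedWalksWithExcursions D k s') : D = C ∧ ∀ j ≤ C.length, s j = s' j := by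
  obtain ⟨hl, hCp, hdir, hs⟩ := hp
  obtain ⟨-, hDp, hdir', hs'⟩ := hp'
  rw [Walk.toSubgraph_le_toSubgraph_iff hC.not_nil] at hCp
  rw [Walk.toSubgraph_le_toSubgraph_iff hD.not_nil] at hDp
  rcases hg.eq_or_eq_reverse (hl ▸ hk) hC hD hCp hDp with rfl | rfl
  · exact ⟨rfl, eq_of_mem_looseExcursionWalks D p s s' ((hasExcursionLengths_iff D p s).mp hs)
      ((hasExcursionLengths_iff D p s').mp hs')⟩
  · exact absurd hdir' hdir.not_reverse

end SimpleGraph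

section Biregular

open SimpleGraph

variable {V : Type*} [Fintype V] {G : SimpleGraph V} [DecidableRel G.Adj] {U W : Set V} {c d : ℕ}

/-- A closed walk that contains a cycle through its initial vertex goes around that cycle with some
sequence of excursion lengths. -/
theorem IsBiregularBipartite.exists_mem_closedWalksWithExcursions
    (hG : IsBiregularBipartite G U W c d) {g i k : ℕ} (hg : G.GirthAtLeast g)
    (hik : i + 2 * k < 2 * g) {v : V} {p : G.Walk v v} (hp : ⟨v, p⟩ ∈ closedWalksOnCycle G i k) :
    ∃ C : G.Walk v v, C.IsCycle ∧ C.length = i ∧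
      ∃ s ∈ (Finset.range (i + 1)).piAntidiag k, p ∈ closedWalksWithExcursions C k s := by
  classical
  obtain ⟨hl, _, ⟨x, D, hD, hDl, rfl⟩, hDp, hv⟩ := hp
  dsimp only at hl hDp hv
  rw [Walk.toSubgraph_le_toSubgraph_iff hD.not_nil] at hDp
  rw [Walk.mem_verts_toSubgraph] at hv
  obtain ⟨X, hX, hX'⟩ := hg.exists_unique_cycle (hl ▸ hik) hD hDp
  have hperm := (D.rotate_edges v hv).perm
  have hDv : (D.rotate v hv).IsCycle := (Walk.isCycle_rotate hv).mpr hD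
  have hDvl : (D.rotate v hv).length = i := by
    rw [← hDl, ← Walk.length_edges, hperm.length_eq, Walk.length_edges]
  obtain ⟨hXc, hXl, hXp⟩ : X.IsCycle ∧ X.length = i ∧ X.edges ⊆ p.edges := by
    have hsub := List.Subset.trans hperm.subset hDp
    rcases hX' _ hDv hsub with rfl | rfl
    · exact ⟨hDv, hDvl, hsub⟩
    · refine ⟨hDv.reverse, by rwa [Walk.length_reverse], ?_⟩
      rw [Walk.edges_reverse]
      exact fun e he => hsub (List.mem_reverse.mp he)
  obtain ⟨s, hs⟩ := exists_mem_looseExcursionWalks (fun q => hG.even_length_iff q) X p hX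
  -- Elements of `piAntidiag` vanish outside the index range, so the irrelevant values of `s` are
  -- set to zero.
  set s' : ℕ → ℕ := fun j => if j < i + 1 then s j else 0 with hs'
  have hps' : p ∈ looseExcursionWalks X s' := by
    rw [looseExcursionWalks_congr X (s' := s)]
    · exact hs
    · intro j hj
      simp only [hs']
      rw [if_pos (by omega)]
  have hsum : ∑ j ∈ Finset.range (X.length + 1), s' j = k := by
    have := length_of_mem_looseExcursionWalks X p s' hps'
    omega
  refine ⟨X, hXc, hXl, s', ?_, ?_⟩
  · rw [Finset.mem_piAntidiag]
    refine ⟨by rw [← hsum, hXl], fun j hj => ?_⟩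
    rw [Finset.mem_range]
    by_contra hcon
    exact hj (if_neg hcon)
  · rw [hg.closedWalksWithExcursions_eq hXc (hXl ▸ hik) hsum]
    exact hg.mem_excursionWalks_of_isCycle hXc (hl ▸ hik) hXp hps'

theorem IsBiregularBipartite.closedWalksOnCycle_eq (hG : IsBiregularBipartite G U W c d)
    {g i k : ℕ} (hg : G.GirthAtLeast g) (hik : i + 2 * k < 2 * g) :
    closedWalksOnCycle G i k =
      ⋃ z ∈ G.rootedCycles i ×ˢ ((Finset.range (i + 1)).piAntidiag k : Set (ℕ → ℕ)),
        Sigma.mk z.1.1 '' closedWalksWithExcursions z.1.2 k z.2 := by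
  ext ⟨v, p⟩
  simp only [Set.mem_iUnion, exists_prop]
  constructor
  · intro hp
    obtain ⟨C, hC, hl, s, hs, hCs⟩ := hG.exists_mem_closedWalksWithExcursions hg hik hp
    exact ⟨⟨⟨v, C⟩, s⟩, ⟨⟨hC, hl⟩, hs⟩, p, hCs, rfl⟩
  · rintro ⟨⟨⟨w, C⟩, s⟩, ⟨⟨hC, hl⟩, -⟩, q, ⟨hql, hCq, -, -⟩, heq⟩
    cases heq
    dsimp only at hl
    exact ⟨hl ▸ hql, _, ⟨w, C, hC, hl, rfl⟩, hCq, C.start_mem_verts_toSubgraph⟩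

theorem IsBiregularBipartite.ncard_closedWalksOnCycle_eq_sum (hG : IsBiregularBipartite G U W c d)
    {g i k : ℕ} (hg : G.GirthAtLeast g) (hik : i + 2 * k < 2 * g) :
    (closedWalksOnCycle G i k).ncard =
      ∑ t ∈ (G.finite_rootedCycles i).toFinset, ∑ s ∈ (Finset.range (i + 1)).piAntidiag k,
        (closedWalksWithExcursions t.2 k s).ncard := by
  have hfin : (G.rootedCycles i ×ˢ
      ((Finset.range (i + 1)).piAntidiag k : Set (ℕ → ℕ))).Finite :=
    (G.finite_rootedCycles i).prod (Finset.finite_toSet _)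
  rw [hG.closedWalksOnCycle_eq hg hik, hfin.ncard_biUnion]
  · rw [finsum_mem_eq_finite_toFinset_sum _ hfin, ← Finset.sum_product']
    refine Finset.sum_congr ?_ fun z _ => ?_
    · ext z
      simp
    · exact Set.ncard_image_of_injective _ sigma_mk_injective
  · exact fun z _ => ((finite_setOf_walk_length_eq _ _ _).subset fun p hp => hp.1).image _
  · rintro ⟨⟨v, C⟩, s⟩ ⟨⟨hC, hCl⟩, hs⟩ ⟨⟨w, D⟩, s'⟩ ⟨⟨hD, hDl⟩, hs'⟩ hne
    rw [Function.onFun, Set.disjoint_left]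
    rintro _ ⟨p, hp, rfl⟩ ⟨q, hq, heq⟩
    apply hne
    dsimp only at hp hq heq hC hD hCl hDl
    obtain ⟨rfl, heq⟩ := Sigma.mk.inj heq
    obtain rfl := eq_of_heq heq
    obtain ⟨rfl, h⟩ := hg.eq_of_mem_closedWalksWithExcursions hC hD (hCl ▸ hik) hp hq
    -- The walk determines the values up to `i`; membership in `piAntidiag` makes the others zero.
    have : s = s' := by
      funext j
      by_cases hj : j < i + 1
      · exact h j (by omega)
      · rw [Finset.mem_coe, Finset.mem_piAntidiag] at hs hs'
        have h₁ : s j = 0 := by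
          by_contra hcon
          exact hj (Finset.mem_range.mp (hs.2 j hcon))
        have h₂ : s' j = 0 := by
          by_contra hcon
          exact hj (Finset.mem_range.mp (hs'.2 j hcon))
        rw [h₁, h₂]
    rw [this]

/-! ### Combining the two parts -/

/-- The involution of `ℕ` that exchanges `2 j` and `2 j + 1` for `2 j + 1 < i`. -/
def swapPairs (i j : ℕ) : ℕ :=
  if j < i then if Even j then j + 1 else j - 1 else j

theorem swapPairs_lt {i : ℕ} (hi : Even i) {j n : ℕ} (hn : i ≤ n) (hj : j < n) :
    swapPairs i j < n := by
  unfold swapPairs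
  obtain ⟨m, rfl⟩ := hi
  split_ifs with h₁ h₂
  · obtain ⟨l, rfl⟩ := h₂
    omega
  · omega
  · exact hj

theorem swapPairs_swapPairs {i : ℕ} (hi : Even i) (j : ℕ) : swapPairs i (swapPairs i j) = j := by
  obtain ⟨m, rfl⟩ := hi
  unfold swapPairs
  by_cases h₁ : j < m + m
  · rcases Nat.even_or_odd' j with ⟨l, rfl | rfl⟩
    · have h₂ : ¬ Even (2 * l + 1) := by simp
      have h₃ : 2 * l + 1 < m + m := by omega
      simp [h₁, h₃]
    · have h₂ : 2 * l < m + m := by omega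
      simp [h₁, h₂]
  · simp [h₁]

/-- A sum over all compositions with the roles of the even and the odd places exchanged. -/
theorem sum_piAntidiag_swap {i : ℕ} (hi : Even i) (k : ℕ) (b f h : ℕ → ℕ) :
    ∑ s ∈ (Finset.range (i + 1)).piAntidiag k,
        b (s i) * ∏ j ∈ Finset.range (i / 2), f (s (2 * j)) * h (s (2 * j + 1)) =
      ∑ s ∈ (Finset.range (i + 1)).piAntidiag k,
        b (s i) * ∏ j ∈ Finset.range (i / 2), h (s (2 * j)) * f (s (2 * j + 1)) := by
  have hlt : ∀ {j}, j < i + 1 → swapPairs i j < i + 1 := swapPairs_lt hi (Nat.le_succ i)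
  have hmem : ∀ s ∈ (Finset.range (i + 1)).piAntidiag k,
      s ∘ swapPairs i ∈ (Finset.range (i + 1)).piAntidiag k := by
    intro s hs
    rw [Finset.mem_piAntidiag] at hs ⊢
    constructor
    · rw [← hs.1]
      refine Finset.sum_nbij' (swapPairs i) (swapPairs i) ?_ ?_ ?_ ?_ ?_
      · exact fun j hj => Finset.mem_range.mpr (hlt (Finset.mem_range.mp hj))
      · exact fun j hj => Finset.mem_range.mpr (hlt (Finset.mem_range.mp hj))
      · exact fun j _ => swapPairs_swapPairs hi j
      · exact fun j _ => swapPairs_swapPairs hi j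
      · exact fun j _ => rfl
    · intro j hj
      have := hlt (Finset.mem_range.mp (hs.2 _ hj))
      rw [swapPairs_swapPairs hi] at this
      exact Finset.mem_range.mpr this
  have hinv : ∀ s : ℕ → ℕ, (s ∘ swapPairs i) ∘ swapPairs i = s :=
    fun s => funext fun j => congrArg s (swapPairs_swapPairs hi j)
  refine Finset.sum_nbij' (fun s => s ∘ swapPairs i) (fun s => s ∘ swapPairs i) hmem hmem
    (fun s _ => hinv s) (fun s _ => hinv s) ?_
  intro s _
  -- The index `i` of the final excursion is fixed, so the factor `b (s i)` is unaffected.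
  have h₀ : swapPairs i i = i := by simp [swapPairs]
  simp only [Function.comp_apply, h₀]
  congr 1
  refine Finset.prod_congr rfl fun j hj => ?_
  rw [Finset.mem_range] at hj
  have h₁ : swapPairs i (2 * j) = 2 * j + 1 := by
    simp [swapPairs, show 2 * j < i by omega]
  have h₂ : swapPairs i (2 * j + 1) = 2 * j := by
    simp [swapPairs, show 2 * j + 1 < i by omega]
  rw [h₁, h₂, mul_comm]

/-- The number of closed walks around the cycles of a given length. -/
theorem IsBiregularBipartite.ncard_closedWalksOnCycle (hG : IsBiregularBipartite G U W c d)
    {g i k : ℕ} (hg : G.GirthAtLeast g) (hik : i + 2 * k < 2 * g) (hi : Even i) {x y : V}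
    (hx : G.degree x = c) (hy : G.degree y = d) :
    (closedWalksOnCycle G i k).ncard =
      i * numCycles G i * ∑ s ∈ (Finset.range (i + 1)).piAntidiag k,
        (numClosedCycleFree G x (2 * s i) + numClosedCycleFree G y (2 * s i)) *
          ∏ j ∈ Finset.range (i / 2),
            numTreeClosed d c (2 * s (2 * j)) * numTreeClosed c d (2 * s (2 * j + 1)) := by
  classical
  -- Stated for arbitrary parts so that it applies to `U` and, by symmetry, to `W`. The inner sum
  -- depends only on the part containing the root, and `i N_i` cycles are rooted there.
  have hcard : ∀ {U' W' : Set V} {c' d' : ℕ} {x' : V}, IsBiregularBipartite G U' W' c' d' →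
      G.degree x' = c' → ∑ t ∈ (G.finite_rootedCycles i).toFinset with t.1 ∈ U',
        ∑ s ∈ (Finset.range (i + 1)).piAntidiag k, (closedWalksWithExcursions t.2 k s).ncard =
      i * numCycles G i * ∑ s ∈ (Finset.range (i + 1)).piAntidiag k,
        numClosedCycleFree G x' (2 * s i) * ∏ j ∈ Finset.range (i / 2),
            numTreeClosed c' d' (2 * s (2 * j)) * numTreeClosed d' c' (2 * s (2 * j + 1)) := by
    intro U' W' c' d' x' hG' hx'
    rw [← hG'.ncard_rootedCycles_inter hg (by omega), ← smul_eq_mul]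
    have hset : G.rootedCycles i ∩ {t | t.1 ∈ U'} =
        (((G.finite_rootedCycles i).toFinset.filter fun t => t.1 ∈ U' :
          Finset (Σ v : V, G.Walk v v)) : Set (Σ v : V, G.Walk v v)) := by
      ext t
      simp
    rw [hset, Set.ncard_coe_finset, ← Finset.sum_const]
    refine Finset.sum_congr rfl fun t ht => Finset.sum_congr rfl fun s hs => ?_
    rw [Finset.mem_filter, Set.Finite.mem_toFinset] at ht
    obtain ⟨⟨hC, rfl⟩, hv⟩ := ht
    exact hG'.ncard_closedWalksWithExcursions hg hv hx' hC hik (Finset.mem_piAntidiag.mp hs).1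
  rw [hG.ncard_closedWalksOnCycle_eq_sum hg hik,
    ← Finset.sum_filter_add_sum_filter_not _ (fun t => t.1 ∈ U), hcard hG hx]
  have hW : ((G.finite_rootedCycles i).toFinset.filter fun t => ¬ t.1 ∈ U) =
      (G.finite_rootedCycles i).toFinset.filter fun t => t.1 ∈ W := by
    refine Finset.filter_congr fun t _ => ⟨fun h => (hG.mem_or_mem _).resolve_left h, ?_⟩
    exact fun h h' => hG.notMem_right h' h
  rw [hW, hcard hG.symm hy, ← mul_add,
    sum_piAntidiag_swap hi k (fun m => numClosedCycleFree G x (2 * m))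
      (fun m => numTreeClosed c d (2 * m)) (fun m => numTreeClosed d c (2 * m)),
    ← Finset.sum_add_distrib]
  simp only [add_mul]

end Biregular

/-! ### The theorem -/

theorem mainTheorem1 {V : Type*} [Fintype V] (G : SimpleGraph V) [DecidableRel G.Adj]
    (U W : Set V) (c d : ℕ) (hG : IsBiregularBipartite G U W c d)
    (i k : ℕ) (hk : 1 ≤ k) (hg : ((i + 2 * k : ℕ) : ℕ∞) < 2 * G.egirth)
    (x y : V) (hx : G.degree x = c) (hy : G.degree y = d) :
    (closedWalksOnCycle G i k).ncard =
        i * numCycles G i *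
          ∑ s ∈ (Finset.range (i + 1)).piAntidiag k,
            (numClosedCycleFree G x (2 * s i) + numClosedCycleFree G y (2 * s i)) *
              ∏ j ∈ Finset.range (i / 2),
                numTreeClosed d c (2 * s (2 * j)) * numTreeClosed c d (2 * s (2 * j + 1)) ∧
    (∀ (v : V) (C : G.Walk v v), C.IsCycle → C.length = i →
      ∀ s : ℕ → ℕ, ∑ j ∈ Finset.range (i + 1), s j = k →
        (v ∈ U → (closedWalksWithExcursions C k s).ncard =
          numClosedCycleFree G x (2 * s i) *
            ∏ j ∈ Finset.range (i / 2),
              numTreeClosed c d (2 * s (2 * j)) * numTreeClosed d c (2 * s (2 * j + 1))) ∧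
        (v ∈ W → (closedWalksWithExcursions C k s).ncard =
          numClosedCycleFree G y (2 * s i) *
            ∏ j ∈ Finset.range (i / 2),
              numTreeClosed d c (2 * s (2 * j)) * numTreeClosed c d (2 * s (2 * j + 1)))) := by
  -- Once a cycle exists the girth is finite, and the length of a shortest cycle serves as the
  -- natural number `g`.
  have hgirth : (∃ C : Σ v : V, G.Walk v v, C.2.IsCycle ∧ C.2.length = i) →
      ∃ g, G.GirthAtLeast g ∧ i + 2 * k < 2 * g := by
    rintro ⟨⟨v, C⟩, hC, -⟩
    obtain ⟨a, w, -, hw⟩ := SimpleGraph.exists_egirth_eq_length.mpr fun h => h C hC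
    refine ⟨w.length, fun u D hD => ?_, ?_⟩
    · have := SimpleGraph.egirth_le_length hD
      rw [hw] at this
      exact_mod_cast this
    · rw [hw] at hg
      exact_mod_cast hg
  refine ⟨?_, ?_⟩
  -- Without cycles of length `i`, as for odd `i` or `i = 0`, both sides vanish. Otherwise the cycle
  -- gives a finite `g` and, being a closed walk in a bipartite graph, the evenness of `i`.
  · by_cases hne : G.rootedCycles i = ∅
    · have h₀ := SimpleGraph.cyclesOfLength_eq_empty hne
      have h₁ : closedWalksOnCycle G i k = ∅ := by
        simp [closedWalksOnCycle, h₀]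
      simp [h₁, numCycles, h₀]
    · obtain ⟨⟨v, C⟩, hC, hl⟩ := Set.nonempty_iff_ne_empty.mpr hne
      obtain ⟨g, hg', hik⟩ := hgirth ⟨⟨v, C⟩, hC, hl⟩
      exact hG.ncard_closedWalksOnCycle hg' hik
        (hl ▸ (hG.even_length_iff C).mpr Iff.rfl) hx hy
  · rintro v C hC rfl s hs
    obtain ⟨g, hg', hik⟩ := hgirth ⟨⟨v, C⟩, hC, rfl⟩
    exact ⟨fun hv => hG.ncard_closedWalksWithExcursions hg' hv hx hC hik hs,
      fun hv => hG.symm.ncard_closedWalksWithExcursions hg' hv hy hC hik hs⟩
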